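/- Let $k$ be an infinite field (for example an algebraically closed field, of any characteristic), let $n\ge 1$, and let $S$ be the $A_n$ surface singularity $xy=z^{n+1}$ at the origin $0$ of $\mathbb A^3_k$. Let $\mathcal H$ be the set of arcs on $S$ centred at $0$, i.e. of triples $(x(t),y(t),z(t))$ of power series in $t\,k[[t]]$ with $x(t)y(t)=z(t)^{n+1}$, with the Zariski topology: the open sets are generated by the sets where a given polynomial in finitely many coefficients of the three series does not vanish. Let $p:X\to S$ be the minimal resolution, that is, the toric surface of the fan with rays through $(0,1),(1,1),\dots,(n+1,1)$, where $x,y,z$ are the characters $(1,0),(-1,n+1),(0,1)$. For an exceptional curve $E$ (an irreducible component of $p^{-1}(0)$), let $N_E\subset\mathcal H$ be the set of arcs having a lift to $X$ (strict transform) that meets $E$ transversally (the ideal of $E$ pulls back to the ideal $(t)$) and does not meet the other exceptional curves. For a function $f$ on $S$, let $\mathrm{ord}_E(f)$ be the order of vanishing of $p^*f$ along $E$. Then there are exactly $n$ exceptional curves, and they can be numbered $E_1,\dots,E_n$ so that, with $N_i=N_{E_i}$: 1. $E_i\cap E_j\neq\emptyset$ if and only if $|i-j|\le 1$; moreover $\mathrm{ord}_{E_i}(x)=i$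 and $\mathrm{ord}_{E_i}(y)=n-i+1$ for all $i$. 2. $\overline{N_i}\not\subset\overline{N_j}$ for all $i\ne j$. 3. Let $N_i^0\subset\mathcal H$ be the explicit family of the arcs $(a_it^i+\cdots,\; b_{n-i+1}t^{n-i+1}+\cdots,\; c_1t+\cdots)$ with $a_i,b_{n-i+1},c_1\ne 0$. Then $N_i^0$ is the set of the arcs of $N_i$ with $c_1\neq 0$, where $c_1$ is the coefficient of $t$ in $z(t)$; one has $N_i^0=N_i$ for $1<i<n$, and $\overline{N_i^0}=\overline{N_i}$ for all $i$. In particular $\overline{N_i^0}\not\subset\overline{N_j^0}$ for all $i\neq j$. 4. (Nash conjecture for $A_n$.) Every $N_i$ is irreducible, $\mathcal H=\bigcup_{i=1}^n\overline{N_i}$, and the irreducible components of $\mathcal H$ are exactly the sets $\overline{N_1},\dots,\overline{N_n}$. Hence $\mathcal H$ has exactly $n$ irreducible components, as many as there are exceptional curves in the minimal resolution. -/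

import Mathlib

universe u

namespace AnNash

open AlgebraicGeometry CategoryTheory CategoryTheory.Limits

noncomputable section

/-! ## The surface singularity of type `A_n` -/

/-- The equation `xy - z^(n+1)`, with the variables numbered `x = X 0`, `y = X 1`, `z = X 2`. -/
def equation (k : Type u) [Field k] (n : ℕ) : MvPolynomial (Fin 3) k :=
  MvPolynomial.X 0 * MvPolynomial.X 1 - MvPolynomial.X 2 ^ (n + 1)

/-- The coordinate ring `k[x, y, z] / (xy - z^(n+1))`. -/
abbrev CoordRing (k : Type u) [Field k] (n : ℕ) : Type u :=
  MvPolynomial (Fin 3) k ⧸ Ideal.span {equation k n}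

/-- The coordinate functions `x` (`j = 0`), `y` (`j = 1`), `z` (`j = 2`) of the surface. -/
def coord (k : Type u) [Field k] (n : ℕ) (j : Fin 3) : CoordRing k n :=
  Ideal.Quotient.mk _ (MvPolynomial.X j)

/-- The affine surface `S = Spec k[x, y, z] / (xy - z^(n+1))`. -/
abbrev surface (k : Type u) [Field k] (n : ℕ) : Scheme.{u} :=
  Spec (CommRingCat.of (CoordRing k n))

/-- The singular point of `S`, as the closed subset `x = y = z = 0`. -/
def origin (k : Type u) [Field k] (n : ℕ) : Set (surface k n) :=
  PrimeSpectrum.zeroLocus (Set.range (coord k n))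

/-! ## The arc space -/

/-- An arc on the germ of `S` at its singular point: a `k`-morphism from the coordinate ring to
`k⟦t⟧` under which the closed point goes to the singular point. -/
structure Arc (k : Type u) [Field k] (n : ℕ) where
  /-- The comorphism of the arc. -/
  hom : CoordRing k n →ₐ[k] PowerSeries k
  centered : ∀ j, PowerSeries.constantCoeff (hom (coord k n j)) = 0

/-- The power series `x(t)`, `y(t)`, `z(t)` of an arc. -/
def Arc.series {k : Type u} [Field k] {n : ℕ} (φ : Arc k n) (j : Fin 3) : PowerSeries k :=
  φ.hom (coord k n j)

/-- The Zariski topology of the arc space: the open sets are generated by the sets where a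
polynomial in (finitely many of) the coefficients of `x(t)`, `y(t)`, `z(t)` does not vanish. -/
instance Arc.instTopologicalSpace (k : Type u) [Field k] (n : ℕ) : TopologicalSpace (Arc k n) :=
  TopologicalSpace.generateFrom
    {U | ∃ P : MvPolynomial (Fin 3 × ℕ) k,
      U = {φ | MvPolynomial.eval (fun a => PowerSeries.coeff a.2 (φ.series a.1)) P ≠ 0}}

/-- An arc as a morphism `Spec k⟦t⟧ ⟶ S`. -/
def Arc.toHom {k : Type u} [Field k] {n : ℕ} (φ : Arc k n) :
    Spec (CommRingCat.of (PowerSeries k)) ⟶ surface k n :=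
  Spec.map (CommRingCat.ofHom φ.hom.toRingHom)

/-- The `i`-th explicit family: the arcs
`(a_i t^i + ⋯, b_{n+1-i} t^{n+1-i} + ⋯, c_1 t + ⋯)` with `a_i, b_{n+1-i}, c_1` nonzero. -/
def explicitFamily (k : Type u) [Field k] (n i : ℕ) : Set (Arc k n) :=
  {φ | (φ.series 0).order = (i : ℕ∞) ∧ (φ.series 1).order = ((n + 1 - i : ℕ) : ℕ∞) ∧
    (φ.series 2).order = 1}

/-! ## Exceptional curves, orders and families of arcs for a morphism onto `S` -/

section Families

variable {k : Type u} [Field k] {n : ℕ} {X : Scheme.{u}} (p : X ⟶ surface k n)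

/-- The exceptional curves of `p`: the irreducible components of the fibre over the singular
point. -/
def exceptionalCurves : Set (Set X) :=
  {E | Maximal (fun F : Set X => IsIrreducible F ∧ F ⊆ p ⁻¹' origin k n) E}

lemma mem_exceptionalCurves {p : X ⟶ surface k n} {E : Set X} :
    E ∈ exceptionalCurves p ↔
      Maximal (fun F : Set X => IsIrreducible F ∧ F ⊆ p ⁻¹' origin k n) E :=
  Iff.rfl

/-- The generic point of an exceptional curve. -/
def genericPt (E : exceptionalCurves p) : X :=
  (Maximal.prop (mem_exceptionalCurves.mp E.2)).1.genericPoint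

/-- The order `ord_E (f)` along `E` of (the pull-back to `X` of) a function `f` on `S`: the order
of vanishing of its germ in the local ring of `X` at the generic point of `E`. -/
def ordAlong (E : exceptionalCurves p) (f : CoordRing k n) : ℕ∞ :=
  Ring.ord (X.presheaf.stalk (genericPt p E))
    ((X.presheaf.germ ⊤ (genericPt p E) trivial).hom
      (p.appTop.hom ((Scheme.ΓSpecIso (CommRingCat.of (CoordRing k n))).inv.hom f)))

/-- The ideal in the local ring of `X` at the point `x` of the integral closed subscheme with
generic point `η`: the germs at `x` that vanish at `η`. -/
def idealAt {X : Scheme.{u}} {η x : X} (h : η ⤳ x) : Ideal (X.presheaf.stalk x) :=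
  (IsLocalRing.maximalIdeal (X.presheaf.stalk η)).comap (X.presheaf.stalkSpecializes h).hom

/-- The origin of the parametrized arc `Spec k⟦t⟧`. -/
def arcOrigin (k : Type u) [Field k] : Spec (CommRingCat.of (PowerSeries k)) :=
  IsLocalRing.closedPoint (PowerSeries k)

/-- The arc `ψ` on `X` meets the curve `E` transversally: its origin lies on `E`, and the ideal of
`E` pulls back to the maximal ideal of `k⟦t⟧`, i.e. the intersection number is `1`. -/
def MeetsTransversally (ψ : Spec (CommRingCat.of (PowerSeries k)) ⟶ X)
    (E : exceptionalCurves p) : Prop :=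
  ∃ h : genericPt p E ⤳ ψ (arcOrigin k),
    (idealAt h).map (ψ.stalkMap (arcOrigin k)).hom =
      IsLocalRing.maximalIdeal
        ((Spec (CommRingCat.of (PowerSeries k))).presheaf.stalk (arcOrigin k))

/-- The family `N_E`: the arcs whose strict transform (lift to `X`) is transverse to `E` and does
not meet the other exceptional curves. -/
def arcFamily (E : exceptionalCurves p) : Set (Arc k n) :=
  {φ | ∃ ψ : Spec (CommRingCat.of (PowerSeries k)) ⟶ X, ψ ≫ p = φ.toHom ∧
    MeetsTransversally p ψ E ∧
    ∀ E' : exceptionalCurves p, E' ≠ E → ψ (arcOrigin k) ∉ (E' : Set X)}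

end Families

/-! ## The minimal resolution of `S`

`S` is the affine toric surface of the cone spanned by `(0, 1)` and `(n + 1, 1)`: on the torus,
`x`, `z`, `y` are the characters `(1, 0)`, `(0, 1)`, `(-1, n + 1)`. Its minimal resolution is the
toric surface of the fan obtained by inserting the rays through the lattice points `(1, 1), …,
(n, 1)`. The chart of the two-dimensional cone spanned by `(i, 1)` and `(i + 1, 1)` is an affine
plane, with coordinates the characters `(-1, i + 1)` and `(1, -i)`. -/

/-- The cones of the fan, ordered by the relation of being a face: a cone is given by the set of
the `i` for which it has the ray through `(i, 1)`, and the cones are the faces of the cones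
spanned by `(i, 1)` and `(i + 1, 1)` for `0 ≤ i ≤ n`. -/
abbrev FanCone (n : ℕ) : Type :=
  {τ : Finset ℕ // ∃ i ≤ n, τ ⊆ {i, i + 1}}

/-- The monoid of the characters `m` of the torus that are nonnegative on a cone. -/
def dualMonoid {n : ℕ} (τ : FanCone n) : AddSubmonoid (ℤ × ℤ) where
  carrier := {m | ∀ i ∈ τ.1, 0 ≤ (i : ℤ) * m.1 + m.2}
  zero_mem' := by
    intro i _
    simp
  add_mem' := by
    intro a b ha hb i hi
    have h1 := ha i hi
    have h2 := hb i hi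
    simp only [Prod.fst_add, Prod.snd_add]
    linarith

lemma mem_dualMonoid {n : ℕ} {τ : FanCone n} {m : ℤ × ℤ} :
    m ∈ dualMonoid τ ↔ ∀ i ∈ τ.1, 0 ≤ (i : ℤ) * m.1 + m.2 :=
  Iff.rfl

/-- The coordinate ring of the affine toric surface of a cone. -/
abbrev ChartRing (k : Type u) [Field k] {n : ℕ} (τ : FanCone n) : Type u :=
  AddMonoidAlgebra k (dualMonoid τ)

/-- A character that is nonnegative on a cone, as a function on the chart. -/
def character (k : Type u) [Field k] {n : ℕ} (τ : FanCone n) (m : ℤ × ℤ)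
    (hm : m ∈ dualMonoid τ) : ChartRing k τ :=
  AddMonoidAlgebra.single ⟨m, hm⟩ 1

lemma dualMonoid_anti {n : ℕ} {τ σ : FanCone n} (h : τ ≤ σ) : dualMonoid σ ≤ dualMonoid τ :=
  fun _ hm i hi => hm i (h hi)

/-- For a face `τ` of `σ`, the inclusion of the coordinate ring of `σ` in that of `τ`. -/
def restrict (k : Type u) [Field k] {n : ℕ} {τ σ : FanCone n} (h : τ ≤ σ) :
    ChartRing k σ →+* ChartRing k τ :=
  AddMonoidAlgebra.mapDomainRingHom k (AddSubmonoid.inclusion (dualMonoid_anti h))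

lemma restrict_single (k : Type u) [Field k] {n : ℕ} {τ σ : FanCone n} (h : τ ≤ σ)
    (m : dualMonoid σ) (a : k) :
    restrict k h (AddMonoidAlgebra.single m a) =
      AddMonoidAlgebra.single (AddSubmonoid.inclusion (dualMonoid_anti h) m) a :=
  AddMonoidAlgebra.mapDomain_single

lemma restrict_injective (k : Type u) [Field k] {n : ℕ} {τ σ : FanCone n} (h : τ ≤ σ) :
    Function.Injective (restrict k h) :=
  AddMonoidAlgebra.mapDomain_injective (AddSubmonoid.inclusion_injective _)

lemma restrict_refl (k : Type u) [Field k] {n : ℕ} (τ : FanCone n) (h : τ ≤ τ) :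
    restrict k h = RingHom.id _ := by
  refine RingHom.ext fun x => ?_
  induction x using AddMonoidAlgebra.induction_linear with
  | zero => simp
  | add x y hx hy => rw [map_add, map_add, hx, hy]
  | single m a => rw [restrict_single]; rfl

lemma restrict_comp (k : Type u) [Field k] {n : ℕ} {τ σ ρ : FanCone n} (h : τ ≤ σ) (h' : σ ≤ ρ) :
    (restrict k h).comp (restrict k h') = restrict k (h.trans h') := by
  refine RingHom.ext fun x => ?_
  induction x using AddMonoidAlgebra.induction_linear with
  | zero => simp
  | add x y hx hy => rw [map_add, map_add, hx, hy]
  | single m a => rw [RingHom.comp_apply, restrict_single, restrict_single, restrict_single]; rfl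

/-- The diagram of the affine toric surfaces of the cones of the fan. -/
def charts (k : Type u) [Field k] (n : ℕ) : FanCone n ⥤ Scheme.{u} where
  obj τ := Spec (CommRingCat.of (ChartRing k τ))
  map f := Spec.map (CommRingCat.ofHom (restrict k (leOfHom f)))
  map_id τ := by
    rw [restrict_refl]
    exact Spec.map_id _
  map_comp f g := by
    rw [← Spec.map_comp, ← CommRingCat.ofHom_comp, restrict_comp]

/-- A character that vanishes on the face `τ` of the cone spanned by `(i, 1)` and `(i + 1, 1)` and
is positive on its other rays. -/
def faceChar (τ : Finset ℕ) (i : ℕ) : ℤ × ℤ :=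
  ((if i + 1 ∈ τ then 0 else 1) - (if i ∈ τ then 0 else 1),
    (if i ∈ τ then 0 else ((i : ℤ) + 1)) - (if i + 1 ∈ τ then 0 else (i : ℤ)))

lemma faceChar_left (τ : Finset ℕ) (i : ℕ) :
    (i : ℤ) * (faceChar τ i).1 + (faceChar τ i).2 = if i ∈ τ then 0 else 1 := by
  unfold faceChar
  split_ifs <;> simp

lemma faceChar_right (τ : Finset ℕ) (i : ℕ) :
    ((i + 1 : ℕ) : ℤ) * (faceChar τ i).1 + (faceChar τ i).2 = if i + 1 ∈ τ then 0 else 1 := by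
  unfold faceChar
  push_cast
  split_ifs <;> ring

lemma faceChar_mem {n : ℕ} {σ : FanCone n} {i : ℕ} (hσ : σ.1 ⊆ {i, i + 1}) (τ : Finset ℕ) :
    faceChar τ i ∈ dualMonoid σ := by
  intro j hj
  have := hσ hj
  simp only [Finset.mem_insert, Finset.mem_singleton] at this
  rcases this with rfl | rfl
  · rw [faceChar_left]; split_ifs <;> simp
  · rw [faceChar_right]; split_ifs <;> simp

lemma neg_faceChar_mem {n : ℕ} {τ : FanCone n} {i : ℕ} (hτ : τ.1 ⊆ {i, i + 1}) :
    -faceChar τ.1 i ∈ dualMonoid τ := by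
  intro j hj
  have := hτ hj
  simp only [Finset.mem_insert, Finset.mem_singleton] at this
  rcases this with rfl | rfl
  · have h := faceChar_left τ.1 j
    rw [if_pos hj] at h
    simp only [Prod.fst_neg, Prod.snd_neg]
    linarith
  · have h := faceChar_right τ.1 i
    rw [if_pos hj] at h
    simp only [Prod.fst_neg, Prod.snd_neg]
    linarith

lemma character_mul (k : Type u) [Field k] {n : ℕ} {τ : FanCone n} {m m' : ℤ × ℤ}
    (hm : m ∈ dualMonoid τ) (hm' : m' ∈ dualMonoid τ) :
    character k τ m hm * character k τ m' hm' = character k τ (m + m') (add_mem hm hm') := by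
  simp [character, AddMonoidAlgebra.single_mul_single]

lemma character_zero (k : Type u) [Field k] {n : ℕ} (τ : FanCone n) :
    character k τ 0 (zero_mem _) = 1 :=
  rfl

lemma character_pow (k : Type u) [Field k] {n : ℕ} {τ : FanCone n} {m : ℤ × ℤ}
    (hm : m ∈ dualMonoid τ) (N : ℕ) :
    character k τ m hm ^ N = character k τ (N • m) (nsmul_mem hm N) := by
  simp [character, AddMonoidAlgebra.single_pow]

lemma restrict_character (k : Type u) [Field k] {n : ℕ} {τ σ : FanCone n} (h : τ ≤ σ) {m : ℤ × ℤ}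
    (hm : m ∈ dualMonoid σ) :
    restrict k h (character k σ m hm) = character k τ m (dualMonoid_anti h hm) := by
  rw [character, restrict_single]; rfl

lemma exists_nsmul_add_mem {n : ℕ} {τ σ : FanCone n} {i : ℕ}
    (hσ : σ.1 ⊆ {i, i + 1}) {m : ℤ × ℤ} (hm : m ∈ dualMonoid τ) :
    ∃ N : ℕ, m + N • faceChar τ.1 i ∈ dualMonoid σ := by
  set N : ℕ := ((i : ℤ) * m.1 + m.2).natAbs + (((i + 1 : ℕ) : ℤ) * m.1 + m.2).natAbs with hN
  refine ⟨N, ?_⟩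
  intro j hj
  have h1 := hσ hj
  simp only [Finset.mem_insert, Finset.mem_singleton] at h1
  have h0 : (j : ℤ) * (m + N • faceChar τ.1 i).1 + (m + N • faceChar τ.1 i).2 =
      ((j : ℤ) * m.1 + m.2) +
        (N : ℤ) * ((j : ℤ) * (faceChar τ.1 i).1 + (faceChar τ.1 i).2) := by
    simp only [Prod.fst_add, Prod.snd_add, Prod.smul_fst, Prod.smul_snd]
    rw [nsmul_eq_mul, nsmul_eq_mul]
    ring
  rw [h0]
  by_cases hjτ : j ∈ τ.1
  · exact add_nonneg (hm j hjτ) (mul_nonneg (Int.natCast_nonneg N) (faceChar_mem hσ τ.1 j hj))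
  · have h3 : (j : ℤ) * (faceChar τ.1 i).1 + (faceChar τ.1 i).2 = 1 := by
      rcases h1 with rfl | rfl
      · rw [faceChar_left, if_neg hjτ]
      · rw [faceChar_right, if_neg hjτ]
    rw [h3, mul_one]
    rcases h1 with rfl | rfl <;> omega

lemma isLocalization_restrict (k : Type u) [Field k] {n : ℕ} {τ σ : FanCone n} (h : τ ≤ σ) {i : ℕ}
    (hσ : σ.1 ⊆ {i, i + 1}) :
    letI := (restrict k h).toAlgebra
    IsLocalization.Away (character k σ (faceChar τ.1 i) (faceChar_mem hσ τ.1)) (ChartRing k τ) := by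
  let _ := (restrict k h).toAlgebra
  have hu : restrict k h (character k σ (faceChar τ.1 i) (faceChar_mem hσ τ.1)) *
      character k τ (-faceChar τ.1 i) (neg_faceChar_mem (subset_trans h hσ)) = 1 := by
    rw [restrict_character, character_mul, ← character_zero]
    congr 1
    exact add_neg_cancel _
  refine IsLocalization.Away.mk _ (.of_mul_eq_one _ hu) ?_ ?_
  · intro x
    induction x using AddMonoidAlgebra.induction_linear with
    | zero => exact ⟨0, 0, by simp⟩
    | add x y hx hy =>
      obtain ⟨N, a, ha⟩ := hx
      obtain ⟨M, b, hb⟩ := hy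
      refine ⟨N + M, a * character k σ _ (faceChar_mem hσ τ.1) ^ M +
        b * character k σ _ (faceChar_mem hσ τ.1) ^ N, ?_⟩
      rw [map_add, map_mul, map_mul, ← ha, ← hb, map_pow, map_pow]
      ring
    | single m a =>
      obtain ⟨N, hN⟩ := exists_nsmul_add_mem hσ m.2
      refine ⟨N, AddMonoidAlgebra.single ⟨_, hN⟩ a, ?_⟩
      change AddMonoidAlgebra.single m a * (restrict k h _) ^ N = restrict k h _
      rw [restrict_character, character_pow, restrict_single, character,
        AddMonoidAlgebra.single_mul_single, mul_one]
      rfl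
  · intro x y hxy
    exact ⟨0, by rw [restrict_injective k h hxy]⟩

instance isOpenImmersion_charts_map (k : Type u) [Field k] (n : ℕ) {τ σ : FanCone n} (f : τ ⟶ σ) :
    IsOpenImmersion ((charts k n).map f) := by
  obtain ⟨i, -, hσ⟩ := σ.2
  let _ := (restrict k (leOfHom f)).toAlgebra
  have := isLocalization_restrict k (leOfHom f) hσ
  exact IsOpenImmersion.of_isLocalization
    (character k σ (faceChar τ.1 i) (faceChar_mem hσ τ.1))

lemma range_charts_map (k : Type u) [Field k] (n : ℕ) {τ σ : FanCone n} (f : τ ⟶ σ) {i : ℕ}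
    (hσ : σ.1 ⊆ {i, i + 1}) :
    Set.range ((charts k n).map f) = (PrimeSpectrum.basicOpen
      (character k σ (faceChar τ.1 i) (faceChar_mem hσ τ.1)) : Set (PrimeSpectrum _)) := by
  let _ := (restrict k (leOfHom f)).toAlgebra
  have := isLocalization_restrict k (leOfHom f) hσ
  exact PrimeSpectrum.localization_away_comap_range (ChartRing k τ) _

/-- The common face of two cones. -/
def interCone {n : ℕ} (τ σ : FanCone n) : FanCone n :=
  ⟨τ.1 ∩ σ.1, by
    obtain ⟨i, hi, h⟩ := τ.2
    exact ⟨i, hi, Finset.inter_subset_left.trans h⟩⟩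

lemma mem_basicOpen_inter (k : Type u) [Field k] {n : ℕ} {τ₁ τ₂ σ : FanCone n} {i : ℕ}
    (hσ : σ.1 ⊆ {i, i + 1}) {P : PrimeSpectrum (ChartRing k σ)}
    (h1 : P ∈ PrimeSpectrum.basicOpen
      (character k σ (faceChar τ₁.1 i) (faceChar_mem hσ τ₁.1)))
    (h2 : P ∈ PrimeSpectrum.basicOpen
      (character k σ (faceChar τ₂.1 i) (faceChar_mem hσ τ₂.1))) :
    P ∈ PrimeSpectrum.basicOpen
      (character k σ (faceChar (interCone τ₁ τ₂).1 i) (faceChar_mem hσ _)) := by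
  rw [PrimeSpectrum.mem_basicOpen] at *
  intro h
  have hd : faceChar τ₁.1 i + faceChar τ₂.1 i - faceChar (interCone τ₁ τ₂).1 i ∈
      dualMonoid σ := by
    intro j hj
    have h0 : (j : ℤ) * (faceChar τ₁.1 i + faceChar τ₂.1 i - faceChar (interCone τ₁ τ₂).1 i).1 +
        (faceChar τ₁.1 i + faceChar τ₂.1 i - faceChar (interCone τ₁ τ₂).1 i).2 =
        ((j : ℤ) * (faceChar τ₁.1 i).1 + (faceChar τ₁.1 i).2) +
        ((j : ℤ) * (faceChar τ₂.1 i).1 + (faceChar τ₂.1 i).2) -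
        ((j : ℤ) * (faceChar (interCone τ₁ τ₂).1 i).1 + (faceChar (interCone τ₁ τ₂).1 i).2) := by
      rw [Prod.fst_sub, Prod.snd_sub, Prod.fst_add, Prod.snd_add]
      ring
    rw [h0]
    have h3 := hσ hj
    simp only [Finset.mem_insert, Finset.mem_singleton] at h3
    rcases h3 with rfl | rfl
    · simp only [faceChar_left, interCone, Finset.mem_inter]
      split_ifs <;> simp_all
    · simp only [faceChar_right, interCone, Finset.mem_inter]
      split_ifs <;> simp_all
  have hmul : character k σ (faceChar τ₁.1 i) (faceChar_mem hσ τ₁.1) *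
      character k σ (faceChar τ₂.1 i) (faceChar_mem hσ τ₂.1) =
      character k σ (faceChar (interCone τ₁ τ₂).1 i) (faceChar_mem hσ _) *
        character k σ _ hd := by
    rw [character_mul, character_mul]
    congr 1
    abel
  have hP := P.asIdeal.mul_mem_right (character k σ _ hd) h
  rw [← hmul] at hP
  exact (P.isPrime.mem_or_mem hP).elim h1 h2

instance isLocallyDirected_charts (k : Type u) [Field k] (n : ℕ) :
    (charts k n ⋙ Scheme.forget).IsLocallyDirected where
  cond := by
    intro τ₁ τ₂ σ f₁ f₂ x₁ x₂ hx
    change (charts k n).map f₁ x₁ = (charts k n).map f₂ x₂ at hx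
    obtain ⟨i, -, hσ⟩ := σ.2
    let g₁ : interCone τ₁ τ₂ ⟶ τ₁ := homOfLE Finset.inter_subset_left
    let g₂ : interCone τ₁ τ₂ ⟶ τ₂ := homOfLE Finset.inter_subset_right
    have h1 : (charts k n).map f₁ x₁ ∈ Set.range ((charts k n).map f₁) := ⟨_, rfl⟩
    have h2 : (charts k n).map f₁ x₁ ∈ Set.range ((charts k n).map f₂) := ⟨_, hx.symm⟩
    have h3 : (charts k n).map f₁ x₁ ∈ Set.range ((charts k n).map (g₁ ≫ f₁)) := by
      rw [range_charts_map k n _ hσ] at h1 h2 ⊢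
      generalize (charts k n).map f₁ x₁ = P at h1 h2 ⊢
      exact mem_basicOpen_inter k hσ h1 h2
    obtain ⟨y, hy⟩ := h3
    refine ⟨interCone τ₁ τ₂, g₁, g₂, y, ?_, ?_⟩
    · change (charts k n).map g₁ y = x₁
      apply ((charts k n).map f₁).isOpenEmbedding.injective
      rw [← Scheme.Hom.comp_apply, ← Functor.map_comp, hy]
    · change (charts k n).map g₂ y = x₂
      apply ((charts k n).map f₂).isOpenEmbedding.injective
      rw [← Scheme.Hom.comp_apply, ← Functor.map_comp, ← hx, ← hy]
      rfl

/-- The characters `x`, `y`, `z` of the torus. -/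
def coordChar (n : ℕ) : Fin 3 → ℤ × ℤ :=
  ![(1, 0), (-1, (n : ℤ) + 1), (0, 1)]

lemma coordChar_mem {n : ℕ} (τ : FanCone n) (j : Fin 3) : coordChar n j ∈ dualMonoid τ := by
  intro l hl
  have hl' : (l : ℤ) ≤ n + 1 := by
    obtain ⟨i, hi, h⟩ := τ.2
    have := h hl
    simp only [Finset.mem_insert, Finset.mem_singleton] at this
    omega
  fin_cases j <;> simp [coordChar]
  omega

/-- The functions `x`, `y`, `z` on the chart of a cone satisfy the equation of the surface. -/
lemma aeval_equation (k : Type u) [Field k] {n : ℕ} (τ : FanCone n) :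
    MvPolynomial.aeval (fun j => character k τ (coordChar n j) (coordChar_mem τ j))
      (equation k n) = 0 := by
  simp only [equation, map_sub, map_mul, map_pow, MvPolynomial.aeval_X]
  rw [character_mul, character_pow, sub_eq_zero]
  congr 1

/-- The morphism from the coordinate ring of `S` to that of the chart of a cone. -/
def toChart (k : Type u) [Field k] {n : ℕ} (τ : FanCone n) : CoordRing k n →ₐ[k] ChartRing k τ :=
  Ideal.Quotient.liftₐ (Ideal.span {equation k n})
    (MvPolynomial.aeval fun j => character k τ (coordChar n j) (coordChar_mem τ j)) (by
      intro a ha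
      obtain ⟨b, rfl⟩ := Ideal.mem_span_singleton.mp ha
      rw [map_mul, aeval_equation, zero_mul])

lemma toChart_coord (k : Type u) [Field k] {n : ℕ} (τ : FanCone n) (j : Fin 3) :
    toChart k τ (coord k n j) = character k τ (coordChar n j) (coordChar_mem τ j) := by
  change MvPolynomial.aeval _ (MvPolynomial.X j) = _
  rw [MvPolynomial.aeval_X]

lemma restrict_comp_toChart (k : Type u) [Field k] {n : ℕ} {τ σ : FanCone n} (h : τ ≤ σ) :
    (restrict k h).comp (toChart k σ).toRingHom = (toChart k τ).toRingHom := by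
  refine Ideal.Quotient.ringHom_ext (MvPolynomial.ringHom_ext (fun a => ?_) fun j => ?_)
  · change restrict k h (toChart k σ (algebraMap k _ a)) = toChart k τ (algebraMap k _ a)
    rw [AlgHom.commutes, AlgHom.commutes]
    exact restrict_single k h 0 a
  · change restrict k h (toChart k σ (coord k n j)) = toChart k τ (coord k n j)
    rw [toChart_coord, toChart_coord, restrict_character]

/-- The minimal resolution `X` of `S`: the gluing of the charts of the fan. -/
def resolution (k : Type u) [Field k] (n : ℕ) : Scheme.{u} :=
  colimit (charts k n)

/-- The morphism `X ⟶ S`, given on the charts by the characters `x`, `y`, `z`. -/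
def resolutionMap (k : Type u) [Field k] (n : ℕ) : resolution k n ⟶ surface k n :=
  colimit.desc (charts k n)
    { pt := surface k n
      ι :=
        { app := fun τ => Spec.map (CommRingCat.ofHom (toChart k τ).toRingHom)
          naturality := by
            intro τ σ f
            change Spec.map _ ≫ Spec.map _ = Spec.map _ ≫ 𝟙 _
            rw [Category.comp_id, ← Spec.map_comp, ← CommRingCat.ofHom_comp,
              restrict_comp_toChart] } }

end

end AnNash

/-! The proof translates the geometry into pairs of power series and then works with one-parameter
families of arcs.

On the chart of the cone spanned by `(l, 1)` and `(l + 1, 1)` the resolution is a plane with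
coordinates `A`, `B`. Their zero loci are the divisors of the two rays, and `x = A^l B^(l+1)`, `y =
A^(n+1-l) B^(n-l)`, `z = A B`. The rays numbered `1, …, n` give the exceptional curves; the rays `0`
and `n + 1` do not. Since `k⟦t⟧` is local, a lift of an arc lies in a single chart, hence is a pair
`(A, B)`. Transversality to a curve says that its coordinate has order `1`; avoiding the other
curves says that the other coordinate is a unit, unless its axis is not exceptional. This is
`arcFamily_excEquiv`.

What remains concerns power series. A polynomial in finitely many coefficients becomes, along a
curve of arcs whose coefficients are polynomials in a parameter `s`, a polynomial in `s`; over an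
infinite field finitely many nonzero ones have a common non-root. This makes limits of curves lie in
closures (`Arc.mem_closure_of_curve`) and sets joined by curves irreducible
(`Arc.isPreirreducible_of_curves`). The explicit families are irreducible because pairs `(A, B)` can
be joined by segments. They cover a dense set because the excess powers of `t` in an arc with `z ≠
0` deform to powers of `t + s`, which are units for `s ≠ 0` (`Arc.exists_mem_closure_of_ne_zero`),
and arcs with `z = 0` are limits of arcs with `z ≠ 0`. No family lies in the closure of another: as
the index grows the order of `x` increases and that of `y` decreases, and an order cannot drop in
the closure. Finitely many irreducible closed sets without inclusions that cover the arc space are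
its components. -/

namespace AnNash

open AlgebraicGeometry CategoryTheory CategoryTheory.Limits

/-! ### Arcs as triples of power series, and closures in the arc space -/

section ArcSpace

/-- The monomials `x`, `y`, `z` in the coordinates `A`, `B` of the chart with number `l`. -/
noncomputable def toricMonomial {R : Type*} [CommRing R] (n l : ℕ) (A B : R) : Fin 3 → R :=
  ![A ^ l * B ^ (l + 1), A ^ (n + 1 - l) * B ^ (n - l), A * B]

lemma toricMonomial_equation {R : Type*} [CommRing R] {n l : ℕ} (hl : l ≤ n) (A B : R) :
    toricMonomial n l A B 0 * toricMonomial n l A B 1 = toricMonomial n l A B 2 ^ (n + 1) := by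
  obtain ⟨m, rfl⟩ := Nat.exists_eq_add_of_le hl
  have h1 : l + m + 1 - l = m + 1 := by omega
  have h2 : l + m - l = m := by omega
  simp only [toricMonomial, Matrix.cons_val, h1, h2]
  ring

lemma map_toricMonomial {R S : Type*} [CommRing R] [CommRing S] (f : R →+* S) (n l : ℕ)
    (A B : R) (j : Fin 3) :
    f (toricMonomial n l A B j) = toricMonomial n l (f A) (f B) j := by
  fin_cases j <;> simp [toricMonomial]

lemma constantCoeff_toricMonomial_left {R : Type*} [CommRing R] {n l : ℕ} (hl : 1 ≤ l)
    (hln : l ≤ n) {A : PowerSeries R} (hA : PowerSeries.constantCoeff A = 0) (B : PowerSeries R)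
    (j : Fin 3) :
    PowerSeries.constantCoeff (toricMonomial n l A B j) = 0 := by
  have h1 : l ≠ 0 := by omega
  have h2 : n + 1 - l ≠ 0 := by omega
  fin_cases j <;> simp [toricMonomial, hA, h1, h2]

lemma constantCoeff_toricMonomial_right {R : Type*} [CommRing R] {n l : ℕ} (hln : l < n)
    (A : PowerSeries R) {B : PowerSeries R} (hB : PowerSeries.constantCoeff B = 0) (j : Fin 3) :
    PowerSeries.constantCoeff (toricMonomial n l A B j) = 0 := by
  have h2 : n - l ≠ 0 := by omega
  fin_cases j <;> simp [toricMonomial, hB, h2]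

variable {k : Type u} [Field k] {n : ℕ}

lemma order_eq_iff_exists_unit {f : PowerSeries k} {m : ℕ} :
    f.order = m ↔ ∃ g : PowerSeries k, PowerSeries.constantCoeff g ≠ 0 ∧
      f = PowerSeries.X ^ m * g := by
  constructor
  · intro h
    have h0 : f ≠ 0 := by
      rintro rfl
      simp at h
    have hd := PowerSeries.X_pow_order_dvd (φ := f)
    rw [h, ENat.toNat_natCast] at hd
    obtain ⟨g, hg⟩ := hd
    refine ⟨g, fun hc => ?_, hg⟩
    have h1 := PowerSeries.coeff_order h0
    rw [h, ENat.toNat_natCast, hg, PowerSeries.coeff_X_pow_mul' ] at h1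
    simp [hc] at h1
  · rintro ⟨g, hg, rfl⟩
    have : g.order = 0 := by
      by_contra h
      exact hg (PowerSeries.order_ne_zero_iff_constCoeff_eq_zero.mp h)
    rw [PowerSeries.order_mul, PowerSeries.order_X_pow, this, add_zero]

lemma order_eq_one_iff {f : PowerSeries k} (h : PowerSeries.constantCoeff f = 0) :
    f.order = 1 ↔ PowerSeries.coeff 1 f ≠ 0 := by
  have := PowerSeries.order_eq_nat (φ := f) (n := 1)
  rw [Nat.cast_one] at this
  rw [this, and_iff_left]
  intro i hi
  obtain rfl : i = 0 := by omega
  simpa using h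

lemma isUnit_iff_constantCoeff_ne_zero {f : PowerSeries k} :
    IsUnit f ↔ PowerSeries.constantCoeff f ≠ 0 := by
  rw [PowerSeries.isUnit_iff_constantCoeff, isUnit_iff_ne_zero]

lemma order_eq_zero_iff {f : PowerSeries k} :
    f.order = 0 ↔ PowerSeries.constantCoeff f ≠ 0 := by
  rw [ne_eq, ← PowerSeries.order_ne_zero_iff_constCoeff_eq_zero, not_not]

lemma Arc.series_equation (φ : Arc k n) : φ.series 0 * φ.series 1 = φ.series 2 ^ (n + 1) := by
  have h : coord k n 0 * coord k n 1 = coord k n 2 ^ (n + 1) := by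
    rw [← sub_eq_zero]
    exact Ideal.Quotient.eq_zero_iff_mem.mpr (Ideal.mem_span_singleton_self (equation k n))
  have h' := congrArg φ.hom h
  rw [map_mul, map_pow] at h'
  exact h'

lemma Arc.ext_series {φ ψ : Arc k n} (h : ∀ j, φ.series j = ψ.series j) : φ = ψ := by
  obtain ⟨f, hf⟩ := φ
  obtain ⟨g, hg⟩ := ψ
  have : f = g := by
    refine Ideal.Quotient.algHom_ext _ (MvPolynomial.algHom_ext fun j => ?_)
    exact h j
  subst this
  rfl

/-- The arc with given power series. -/
noncomputable def Arc.ofSeries (f : Fin 3 → PowerSeries k) (hf : f 0 * f 1 = f 2 ^ (n + 1))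
    (h0 : ∀ j, PowerSeries.constantCoeff (f j) = 0) : Arc k n where
  hom := Ideal.Quotient.liftₐ (Ideal.span {equation k n}) (MvPolynomial.aeval f) (by
    intro a ha
    obtain ⟨b, rfl⟩ := Ideal.mem_span_singleton.mp ha
    rw [map_mul, equation, map_sub, map_mul, map_pow]
    simp [hf])
  centered j := by
    change PowerSeries.constantCoeff (MvPolynomial.aeval f (MvPolynomial.X j)) = 0
    rw [MvPolynomial.aeval_X, h0]

lemma Arc.series_ofSeries (f : Fin 3 → PowerSeries k) (hf : f 0 * f 1 = f 2 ^ (n + 1))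
    (h0 : ∀ j, PowerSeries.constantCoeff (f j) = 0) (j : Fin 3) :
    (Arc.ofSeries f hf h0).series j = f j := by
  change MvPolynomial.aeval f (MvPolynomial.X j) = f j
  rw [MvPolynomial.aeval_X]

/-- The coefficients of the three power series of an arc. -/
noncomputable def Arc.coeffs (φ : Arc k n) (a : Fin 3 × ℕ) : k :=
  PowerSeries.coeff a.2 (φ.series a.1)

/-- A product of two polynomials is nonzero at an arc exactly when both are, so the generating sets
are already stable under intersection. Closure can thus be tested on one polynomial at a time. -/
lemma Arc.isTopologicalBasis : TopologicalSpace.IsTopologicalBasis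
    {U : Set (Arc k n) | ∃ P : MvPolynomial (Fin 3 × ℕ) k,
      U = {φ | MvPolynomial.eval φ.coeffs P ≠ 0}} where
  exists_subset_inter := by
    rintro _ ⟨P, rfl⟩ _ ⟨Q, rfl⟩ φ ⟨h1, h2⟩
    refine ⟨_, ⟨P * Q, rfl⟩, ?_, ?_⟩
    · change MvPolynomial.eval φ.coeffs (P * Q) ≠ 0
      rw [map_mul]
      exact mul_ne_zero h1 h2
    · intro ψ (hψ : MvPolynomial.eval ψ.coeffs (P * Q) ≠ 0)
      rw [map_mul] at hψ
      exact ⟨left_ne_zero_of_mul hψ, right_ne_zero_of_mul hψ⟩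
  sUnion_eq := Set.eq_univ_of_forall fun φ => ⟨_, ⟨1, rfl⟩, by simp⟩
  eq_generateFrom := rfl

lemma Arc.mem_closure_iff {φ : Arc k n} {A : Set (Arc k n)} :
    φ ∈ closure A ↔ ∀ P : MvPolynomial (Fin 3 × ℕ) k, MvPolynomial.eval φ.coeffs P ≠ 0 →
      ∃ ψ ∈ A, MvPolynomial.eval ψ.coeffs P ≠ 0 := by
  rw [Arc.isTopologicalBasis.mem_closure_iff]
  constructor
  · intro h P hP
    obtain ⟨ψ, h1, h2⟩ := h _ ⟨P, rfl⟩ hP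
    exact ⟨ψ, h2, h1⟩
  · rintro h _ ⟨P, rfl⟩ hP
    obtain ⟨ψ, h1, h2⟩ := h P hP
    exact ⟨ψ, h2, h1⟩

lemma Arc.coeff_eq_zero_of_mem_closure {A : Set (Arc k n)} (a : Fin 3 × ℕ)
    (h : ∀ ψ ∈ A, ψ.coeffs a = 0) {φ : Arc k n} (hφ : φ ∈ closure A) : φ.coeffs a = 0 := by
  by_contra h0
  obtain ⟨ψ, hψ, h1⟩ := Arc.mem_closure_iff.mp hφ (MvPolynomial.X a) (by simpa using h0)
  exact h1 (by simpa using h ψ hψ)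

/-! ### Polynomial curves in the arc space -/

/-- Specialization at a parameter `s` of a power series with polynomial coefficients. -/
noncomputable abbrev specialize (s : k) : PowerSeries (Polynomial k) →+* PowerSeries k :=
  PowerSeries.map (Polynomial.evalRingHom s)

lemma specialize_map_C (s : k) (f : PowerSeries k) :
    specialize s (PowerSeries.map Polynomial.C f) = f := by
  ext m
  simp

/-- The curve in the arc space given by power series with polynomial coefficients. -/
noncomputable def Arc.curve (F : Fin 3 → PowerSeries (Polynomial k))
    (hF : F 0 * F 1 = F 2 ^ (n + 1)) (h0 : ∀ j, PowerSeries.constantCoeff (F j) = 0) (s : k) :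
    Arc k n :=
  Arc.ofSeries (fun j => specialize s (F j))
    (by simp only [← map_mul, ← map_pow, hF])
    (fun j => by
      rw [← PowerSeries.coeff_zero_eq_constantCoeff_apply, PowerSeries.coeff_map,
        PowerSeries.coeff_zero_eq_constantCoeff_apply, h0, map_zero])

lemma Arc.series_curve (F : Fin 3 → PowerSeries (Polynomial k))
    (hF : F 0 * F 1 = F 2 ^ (n + 1)) (h0 : ∀ j, PowerSeries.constantCoeff (F j) = 0) (s : k)
    (j : Fin 3) : (Arc.curve F hF h0 s).series j = specialize s (F j) :=
  Arc.series_ofSeries _ _ _ j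

/-- Substituting the polynomial coefficients of `F` into `P` gives a polynomial in the parameter,
and evaluation commutes with substitution. -/
lemma Arc.exists_polynomial_curve (F : Fin 3 → PowerSeries (Polynomial k))
    (hF : F 0 * F 1 = F 2 ^ (n + 1)) (h0 : ∀ j, PowerSeries.constantCoeff (F j) = 0)
    (P : MvPolynomial (Fin 3 × ℕ) k) : ∃ p : Polynomial k, ∀ s,
      p.eval s = MvPolynomial.eval (Arc.curve F hF h0 s).coeffs P := by
  refine ⟨MvPolynomial.eval₂ Polynomial.C (fun a => PowerSeries.coeff a.2 (F a.1)) P, fun s => ?_⟩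
  rw [← Polynomial.coe_evalRingHom, MvPolynomial.hom_eval₂, MvPolynomial.eval]
  have h1 : (Polynomial.evalRingHom s).comp Polynomial.C = RingHom.id k := by
    ext a
    simp
  rw [h1, MvPolynomial.coe_eval₂Hom]
  congr 1
  ext a
  simp [Arc.coeffs, Arc.series_curve]

variable [Infinite k]

/-- If `P` is nonzero at the arc of parameter `s₀`, its pull-back to the curve is a nonzero
polynomial, and so is its product with `q`; a non-root exists since `k` is infinite. Asking only for
membership in `closure A` lets two degenerations be chained. -/
lemma Arc.mem_closure_of_curve {A : Set (Arc k n)} {φ : Arc k n}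
    (F : Fin 3 → PowerSeries (Polynomial k)) (hF : F 0 * F 1 = F 2 ^ (n + 1))
    (h0 : ∀ j, PowerSeries.constantCoeff (F j) = 0) (s₀ : k)
    (hφ : ∀ j, φ.series j = specialize s₀ (F j)) {q : Polynomial k} (hq : q ≠ 0)
    (hA : ∀ s, q.eval s ≠ 0 → Arc.curve F hF h0 s ∈ closure A) : φ ∈ closure A := by
  have hφ' : φ = Arc.curve F hF h0 s₀ := Arc.ext_series fun j => by rw [hφ, Arc.series_curve]
  rw [← closure_closure, Arc.mem_closure_iff]
  intro P hP
  obtain ⟨p, hp⟩ := Arc.exists_polynomial_curve F hF h0 P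
  rw [hφ', ← hp] at hP
  have hp0 : p ≠ 0 := by
    rintro rfl
    simp at hP
  obtain ⟨s, hs⟩ : ∃ s, (p * q).eval s ≠ 0 := by
    by_contra! h
    exact mul_ne_zero hp0 hq (Polynomial.funext fun s => by simpa using h s)
  rw [Polynomial.eval_mul] at hs
  exact ⟨_, hA s (right_ne_zero_of_mul hs), by rw [← hp]; exact left_ne_zero_of_mul hs⟩

lemma Arc.isPreirreducible_of_curves {A : Set (Arc k n)}
    (h : ∀ φ ∈ A, ∀ ψ ∈ A, ∃ (F : Fin 3 → PowerSeries (Polynomial k))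
      (hF : F 0 * F 1 = F 2 ^ (n + 1)) (h0 : ∀ j, PowerSeries.constantCoeff (F j) = 0)
      (q : Polynomial k), q ≠ 0 ∧ (∀ j, φ.series j = specialize 0 (F j)) ∧
        (∀ j, ψ.series j = specialize 1 (F j)) ∧
        ∀ s, q.eval s ≠ 0 → Arc.curve F hF h0 s ∈ A) : IsPreirreducible A := by
  rintro U V hU hV ⟨φ, hφA, hφU⟩ ⟨ψ, hψA, hψV⟩
  obtain ⟨_, ⟨P, rfl⟩, hP, hPU⟩ := Arc.isTopologicalBasis.exists_subset_of_mem_open hφU hU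
  obtain ⟨_, ⟨Q, rfl⟩, hQ, hQV⟩ := Arc.isTopologicalBasis.exists_subset_of_mem_open hψV hV
  obtain ⟨F, hF, h0, r, hr, hφ, hψ, hA⟩ := h φ hφA ψ hψA
  obtain ⟨p, hp⟩ := Arc.exists_polynomial_curve F hF h0 P
  obtain ⟨q, hq⟩ := Arc.exists_polynomial_curve F hF h0 Q
  have hφ' : φ = Arc.curve F hF h0 0 := Arc.ext_series fun j => by rw [hφ, Arc.series_curve]
  have hψ' : ψ = Arc.curve F hF h0 1 := Arc.ext_series fun j => by rw [hψ, Arc.series_curve]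
  have hp0 : p ≠ 0 := by
    rintro rfl
    have := hp 0
    rw [← hφ'] at this
    exact hP (by simpa using this.symm)
  have hq0 : q ≠ 0 := by
    rintro rfl
    have := hq 1
    rw [← hψ'] at this
    exact hQ (by simpa using this.symm)
  -- A single parameter that stays in `A` and in both open sets at once.
  obtain ⟨s, hs⟩ : ∃ s, (p * q * r).eval s ≠ 0 := by
    by_contra! h
    exact mul_ne_zero (mul_ne_zero hp0 hq0) hr (Polynomial.funext fun s => by simpa using h s)
  rw [Polynomial.eval_mul, Polynomial.eval_mul] at hs
  refine ⟨Arc.curve F hF h0 s, hA s (right_ne_zero_of_mul hs), hPU ?_, hQV ?_⟩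
  · change MvPolynomial.eval _ P ≠ 0
    rw [← hp]
    exact left_ne_zero_of_mul (left_ne_zero_of_mul hs)
  · change MvPolynomial.eval _ Q ≠ 0
    rw [← hq]
    exact right_ne_zero_of_mul (left_ne_zero_of_mul hs)

end ArcSpace

/-! ### The families in chart coordinates: inclusions, irreducibility, closures -/

section Families

variable {k : Type u} [Field k] {n : ℕ}

/-- The arcs with a lift to one of the two charts along the `i`-th exceptional curve that is
transverse to this curve and does not meet the other exceptional curves. -/
def transversalFamily (k : Type u) [Field k] (n i : ℕ) : Set (Arc k n) :=
  {φ | ∃ A B : PowerSeries k,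
    ((∀ j, φ.series j = toricMonomial n i A B j) ∧ A.order = 1 ∧
      (i < n → PowerSeries.constantCoeff B ≠ 0)) ∨
    ((∀ j, φ.series j = toricMonomial n (i - 1) A B j) ∧ B.order = 1 ∧
      (1 < i → PowerSeries.constantCoeff A ≠ 0))}

lemma mem_explicitFamily_of_left {i : ℕ} {φ : Arc k n} {A B : PowerSeries k}
    (hφ : ∀ j, φ.series j = toricMonomial n i A B j) (hA : A.order = 1)
    (hB : PowerSeries.constantCoeff B ≠ 0) : φ ∈ explicitFamily k n i := by
  have hB' := order_eq_zero_iff.mpr hB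
  refine ⟨?_, ?_, ?_⟩ <;> rw [hφ] <;>
    simp [toricMonomial, PowerSeries.order_mul, PowerSeries.order_pow, hA, hB']

lemma mem_explicitFamily_of_right {i : ℕ} (hi : 1 ≤ i) {φ : Arc k n} {A B : PowerSeries k}
    (hφ : ∀ j, φ.series j = toricMonomial n (i - 1) A B j) (hB : B.order = 1)
    (hA : PowerSeries.constantCoeff A ≠ 0) : φ ∈ explicitFamily k n i := by
  have hA' := order_eq_zero_iff.mpr hA
  have h1 : i - 1 + 1 = i := by omega
  have h2 : n - (i - 1) = n + 1 - i := by omega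
  refine ⟨?_, ?_, ?_⟩ <;> rw [hφ]
  · simp [toricMonomial, PowerSeries.order_mul, PowerSeries.order_pow, hA', hB, h1]
  · simp [toricMonomial, PowerSeries.order_mul, PowerSeries.order_pow, hA', hB, h2]
  · simp [toricMonomial, PowerSeries.order_mul, hA', hB]

/-- The chart coordinates are rational functions of `x` and `z`, namely `B = x / z^i` and `A = z /
B`, so the leading terms of `x` and `z` decide whether the arc lifts; `y` is then forced by the
equation of the surface. -/
lemma mem_explicitFamily_iff {i : ℕ} (hin : i ≤ n) {φ : Arc k n} :
    φ ∈ explicitFamily k n i ↔ ∃ A B : PowerSeries k, (∀ j, φ.series j = toricMonomial n i A B j) ∧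
      A.order = 1 ∧ PowerSeries.constantCoeff B ≠ 0 := by
  refine ⟨?_, fun ⟨A, B, hφ, hA, hB⟩ => mem_explicitFamily_of_left hφ hA hB⟩
  rintro ⟨hx, -, hz⟩
  rw [← Nat.cast_one (R := ℕ∞)] at hz
  obtain ⟨u, hu, hxu⟩ := order_eq_iff_exists_unit.mp hx
  obtain ⟨w, hw, hzw⟩ := order_eq_iff_exists_unit.mp hz
  obtain ⟨u, rfl⟩ := isUnit_iff_constantCoeff_ne_zero.mpr hu
  obtain ⟨w, rfl⟩ := isUnit_iff_constantCoeff_ne_zero.mpr hw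
  rw [pow_one] at hzw
  have hB : PowerSeries.constantCoeff ((u * w⁻¹ ^ i : (PowerSeries k)ˣ) : PowerSeries k) ≠ 0 :=
    isUnit_iff_constantCoeff_ne_zero.mp (Units.isUnit _)
  have hA : (PowerSeries.X * ((w * (u * w⁻¹ ^ i)⁻¹ : (PowerSeries k)ˣ) : PowerSeries k)).order
      = 1 := by
    rw [PowerSeries.order_mul, PowerSeries.order_X, PowerSeries.order_zero_of_unit (Units.isUnit _),
      add_zero]
  -- With `x = t^i u` and `z = t w`, this is the unit `B = x / z^i`, and `A = t w b⁻¹`.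
  generalize hb : u * w⁻¹ ^ i = b at *
  have hub : u = (w * b⁻¹) ^ i * b ^ (i + 1) := by
    rw [mul_pow, inv_pow, pow_succ, mul_assoc, inv_mul_cancel_left, mul_comm, ← hb]
    simp
  have h0 : φ.series 0 =
      toricMonomial n i (PowerSeries.X * ((w * b⁻¹ : (PowerSeries k)ˣ) : PowerSeries k))
        (b : PowerSeries k) 0 := by
    rw [hxu, hub]
    simp only [toricMonomial, Matrix.cons_val, mul_pow, mul_assoc, Units.val_pow_eq_pow_val,
      Units.val_mul]
  have h2 : φ.series 2 =
      toricMonomial n i (PowerSeries.X * ((w * b⁻¹ : (PowerSeries k)ˣ) : PowerSeries k))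
        (b : PowerSeries k) 2 := by
    rw [hzw]
    simp [toricMonomial, mul_assoc]
  refine ⟨_, _, ?_, hA, hB⟩
  have h1 : φ.series 1 =
      toricMonomial n i (PowerSeries.X * ((w * b⁻¹ : (PowerSeries k)ˣ) : PowerSeries k))
        (b : PowerSeries k) 1 := by
    have hne : φ.series 0 ≠ 0 := by
      intro h
      rw [h] at hx
      simp at hx
    apply mul_left_cancel₀ hne
    rw [φ.series_equation, h2, ← toricMonomial_equation hin, h0]
  intro j
  fin_cases j
  exacts [h0, h1, h2]

lemma explicitFamily_subset_transversalFamily {i : ℕ} (hin : i ≤ n) :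
    explicitFamily k n i ⊆ transversalFamily k n i := by
  intro φ hφ
  obtain ⟨A, B, h, hA, hB⟩ := (mem_explicitFamily_iff hin).mp hφ
  exact ⟨A, B, .inl ⟨h, hA, fun _ => hB⟩⟩

lemma transversalFamily_eq_explicitFamily {i : ℕ} (hi : 1 < i) (hin : i < n) :
    transversalFamily k n i = explicitFamily k n i := by
  refine subset_antisymm ?_ (explicitFamily_subset_transversalFamily hin.le)
  rintro φ ⟨A, B, ⟨h, hA, hB⟩ | ⟨h, hB, hA⟩⟩
  · exact mem_explicitFamily_of_left h hA (hB hin)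
  · exact mem_explicitFamily_of_right hi.le h hB (hA hi)

/-- Since `z = A B` and one factor has order `1`, the series `z` has order `1` exactly when the
other factor is a unit. This is the only condition that can fail, and only on the two extreme
curves. -/
lemma transversalFamily_inter {i : ℕ} (hi : 1 ≤ i) (hin : i ≤ n) :
    transversalFamily k n i ∩ {φ | PowerSeries.coeff 1 (φ.series 2) ≠ 0} =
      explicitFamily k n i := by
  apply subset_antisymm
  · rintro φ ⟨⟨A, B, h⟩, hφ⟩
    have hz : (φ.series 2).order = 1 := (order_eq_one_iff (φ.centered 2)).mpr hφ
    rcases h with ⟨h, hA, -⟩ | ⟨h, hB, -⟩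
    · refine mem_explicitFamily_of_left h hA (order_eq_zero_iff.mp ?_)
      replace hz : (A * B).order = 1 := by rw [← hz, h]; rfl
      rw [PowerSeries.order_mul, hA] at hz
      exact ENat.add_right_injective_of_ne_top ENat.one_ne_top (hz.trans (add_zero 1).symm)
    · refine mem_explicitFamily_of_right hi h hB (order_eq_zero_iff.mp ?_)
      replace hz : (A * B).order = 1 := by rw [← hz, h]; rfl
      rw [PowerSeries.order_mul, hB] at hz
      exact ENat.add_left_injective_of_ne_top ENat.one_ne_top (hz.trans (zero_add 1).symm)
  · exact fun φ hφ => ⟨explicitFamily_subset_transversalFamily hin hφ,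
      (order_eq_one_iff (φ.centered 2)).mp hφ.2.2⟩

lemma explicitFamily_nonempty {i : ℕ} (hi : 1 ≤ i) (hin : i ≤ n) :
    (explicitFamily k n i).Nonempty :=
  ⟨Arc.ofSeries (toricMonomial n i PowerSeries.X 1) (toricMonomial_equation hin _ _)
    (constantCoeff_toricMonomial_left hi hin (by simp) _),
    mem_explicitFamily_of_left (Arc.series_ofSeries _ _ _) PowerSeries.order_X (by simp)⟩

/-- Vanishing of a coefficient is a closed condition, so orders cannot drop in the closure. For `i <
j` the order of `x` is the obstruction; for `i > j` it is that of `y`. -/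
lemma not_explicitFamily_subset_closure {i j : ℕ} (hi : 1 ≤ i) (hin : i ≤ n) (hjn : j ≤ n)
    (hij : i ≠ j) : ¬ explicitFamily k n i ⊆ closure (explicitFamily k n j) := by
  intro h
  obtain ⟨φ, hφ⟩ := explicitFamily_nonempty (k := k) hi hin
  have h1 := h hφ
  have key : ∀ (j₀ : Fin 3) (m m' : ℕ), m < m' → (φ.series j₀).order = m →
      (∀ ψ ∈ explicitFamily k n j, (ψ.series j₀).order = m') → False := by
    intro j₀ m m' hm hm1 hm2
    refine (PowerSeries.order_eq_nat.mp hm1).1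
      (Arc.coeff_eq_zero_of_mem_closure (j₀, m) (fun ψ hψ => ?_) h1)
    exact (PowerSeries.order_eq_nat.mp (hm2 ψ hψ)).2 m hm
  rcases lt_or_gt_of_ne hij with hlt | hlt
  · exact key 0 i j hlt hφ.1 fun ψ hψ => hψ.1
  · exact key 1 (n + 1 - i) (n + 1 - j) (by omega) hφ.2.1 fun ψ hψ => hψ.2.1

lemma constantCoeff_specialize (s : k) (f : PowerSeries (Polynomial k)) :
    PowerSeries.constantCoeff (specialize s f) = (PowerSeries.constantCoeff f).eval s := by
  rw [← PowerSeries.coeff_zero_eq_constantCoeff_apply, PowerSeries.coeff_map]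
  simp

lemma constantCoeff_map_C (f : PowerSeries k) :
    PowerSeries.constantCoeff (PowerSeries.map Polynomial.C f) =
      Polynomial.C (PowerSeries.constantCoeff f) := by
  rw [← PowerSeries.coeff_zero_eq_constantCoeff_apply, PowerSeries.coeff_map]
  simp

lemma constantCoeff_eq_zero_of_order_eq_one {f : PowerSeries k} (h : f.order = 1) :
    PowerSeries.constantCoeff f = 0 :=
  PowerSeries.order_ne_zero_iff_constCoeff_eq_zero.mp (by simp [h])

/-- The segment joining two power series, as a power series with polynomial coefficients. -/
noncomputable def segment (f g : PowerSeries k) : PowerSeries (Polynomial k) :=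
  PowerSeries.C (1 - Polynomial.X) * PowerSeries.map Polynomial.C f +
    PowerSeries.C Polynomial.X * PowerSeries.map Polynomial.C g

lemma coeff_segment (f g : PowerSeries k) (m : ℕ) :
    PowerSeries.coeff m (segment f g) = (1 - Polynomial.X) * Polynomial.C (PowerSeries.coeff m f) +
      Polynomial.X * Polynomial.C (PowerSeries.coeff m g) := by
  simp only [segment, map_add, PowerSeries.coeff_C_mul, PowerSeries.coeff_map]

lemma specialize_segment_zero (f g : PowerSeries k) : specialize 0 (segment f g) = f := by
  ext m
  simp [coeff_segment]

lemma specialize_segment_one (f g : PowerSeries k) : specialize 1 (segment f g) = g := by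
  ext m
  simp [coeff_segment]

lemma coeff_segment_ne_zero {f : PowerSeries k} (g : PowerSeries k) {m : ℕ}
    (h : PowerSeries.coeff m f ≠ 0) : PowerSeries.coeff m (segment f g) ≠ 0 := by
  intro h0
  rw [coeff_segment] at h0
  exact h (by simpa using congrArg (Polynomial.eval 0) h0)

variable [Infinite k]

/-- The family is the image of the pairs `(A, B)` with `A` of order `1` and `B` a unit. The segment
between two such pairs stays among them wherever the coefficient of `t` in `A` and the constant term
of `B` are nonzero. -/
lemma isIrreducible_explicitFamily {i : ℕ} (hi : 1 ≤ i) (hin : i ≤ n) :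
    IsIrreducible (explicitFamily k n i) := by
  refine ⟨explicitFamily_nonempty hi hin, Arc.isPreirreducible_of_curves ?_⟩
  intro φ hφ ψ hψ
  obtain ⟨A, B, h, hA, hB⟩ := (mem_explicitFamily_iff hin).mp hφ
  obtain ⟨A', B', h', hA', hB'⟩ := (mem_explicitFamily_iff hin).mp hψ
  have hA0 := constantCoeff_eq_zero_of_order_eq_one hA
  have hA0' := constantCoeff_eq_zero_of_order_eq_one hA'
  have hc : PowerSeries.constantCoeff (segment A A') = 0 := by
    rw [← PowerSeries.coeff_zero_eq_constantCoeff_apply, coeff_segment]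
    simp [hA0, hA0']
  refine ⟨toricMonomial n i (segment A A') (segment B B'), toricMonomial_equation hin _ _,
    constantCoeff_toricMonomial_left hi hin hc _,
    PowerSeries.coeff 1 (segment A A') * PowerSeries.coeff 0 (segment B B'),
    mul_ne_zero (coeff_segment_ne_zero _ ((order_eq_one_iff hA0).mp hA))
      (coeff_segment_ne_zero _ (by simpa using hB)),
    fun j => ?_, fun j => ?_, fun s hs => ?_⟩
  · rw [h, map_toricMonomial, specialize_segment_zero, specialize_segment_zero]
  · rw [h', map_toricMonomial, specialize_segment_one, specialize_segment_one]
  · rw [Polynomial.eval_mul] at hs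
    refine mem_explicitFamily_of_left
      (fun j => (Arc.series_curve _ _ _ s j).trans (map_toricMonomial _ n i _ _ j)) ?_ ?_
    · rw [order_eq_one_iff (by rw [constantCoeff_specialize, hc, Polynomial.eval_zero])]
      simpa using left_ne_zero_of_mul hs
    · rw [constantCoeff_specialize]
      simpa using right_ne_zero_of_mul hs

/-- Adding a constant `s` to the coordinate that need not be a unit makes it one for all but one
value of `s`. -/
lemma transversalFamily_subset_closure {i : ℕ} (hi : 1 ≤ i) (hin : i ≤ n) :
    transversalFamily k n i ⊆ closure (explicitFamily k n i) := by
  have hq : ∀ c : k, Polynomial.C c + Polynomial.X ≠ 0 := fun c h => by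
    have := congrArg (Polynomial.coeff · 1) h
    simp at this
  have h00 : ∀ f : PowerSeries k, specialize 0 (PowerSeries.map Polynomial.C f +
      PowerSeries.C Polynomial.X) = f := fun f => by
    rw [map_add, specialize_map_C, PowerSeries.map_C]
    simp
  have hs0 : ∀ (f : PowerSeries k) (s : k), (Polynomial.C (PowerSeries.constantCoeff f) +
      Polynomial.X).eval s ≠ 0 → PowerSeries.constantCoeff (specialize s
        (PowerSeries.map Polynomial.C f + PowerSeries.C Polynomial.X)) ≠ 0 := by
    intro f s hs
    rwa [constantCoeff_specialize, map_add, constantCoeff_map_C, PowerSeries.constantCoeff_C]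
  rintro φ ⟨A, B, ⟨h, hA, -⟩ | ⟨h, hB, -⟩⟩
  · have hA0 : PowerSeries.constantCoeff (PowerSeries.map Polynomial.C A) = 0 := by
      rw [constantCoeff_map_C, constantCoeff_eq_zero_of_order_eq_one hA, map_zero]
    refine Arc.mem_closure_of_curve
      (toricMonomial n i (PowerSeries.map Polynomial.C A)
        (PowerSeries.map Polynomial.C B + PowerSeries.C Polynomial.X))
      (toricMonomial_equation hin _ _) (constantCoeff_toricMonomial_left hi hin hA0 _) 0
      (fun j => ?_) (hq (PowerSeries.constantCoeff B)) fun s hs => subset_closure ?_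
    · rw [map_toricMonomial, specialize_map_C, h00, h]
    · refine mem_explicitFamily_of_left
        (fun j => (Arc.series_curve _ _ _ s j).trans (map_toricMonomial _ n i _ _ j)) ?_ (hs0 _ _ hs)
      rw [specialize_map_C, hA]
  · have hB0 : PowerSeries.constantCoeff (PowerSeries.map Polynomial.C B) = 0 := by
      rw [constantCoeff_map_C, constantCoeff_eq_zero_of_order_eq_one hB, map_zero]
    refine Arc.mem_closure_of_curve
      (toricMonomial n (i - 1) (PowerSeries.map Polynomial.C A + PowerSeries.C Polynomial.X)
        (PowerSeries.map Polynomial.C B))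
      (toricMonomial_equation (by omega) _ _)
      (constantCoeff_toricMonomial_right (by omega) _ hB0) 0
      (fun j => ?_) (hq (PowerSeries.constantCoeff A)) fun s hs => subset_closure ?_
    · rw [map_toricMonomial, specialize_map_C, h00, h]
    · refine mem_explicitFamily_of_right hi
        (fun j => (Arc.series_curve _ _ _ s j).trans (map_toricMonomial _ n (i - 1) _ _ j)) ?_
        (hs0 _ _ hs)
      rw [specialize_map_C, hB]

lemma closure_transversalFamily {i : ℕ} (hi : 1 ≤ i) (hin : i ≤ n) :
    closure (transversalFamily k n i) = closure (explicitFamily k n i) :=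
  subset_antisymm (closure_minimal (transversalFamily_subset_closure hi hin) isClosed_closure)
    (closure_mono (explicitFamily_subset_transversalFamily hin))

lemma isIrreducible_transversalFamily {i : ℕ} (hi : 1 ≤ i) (hin : i ≤ n) :
    IsIrreducible (transversalFamily k n i) := by
  rw [← isIrreducible_iff_closure, closure_transversalFamily hi hin, isIrreducible_iff_closure]
  exact isIrreducible_explicitFamily hi hin

/-! ### The families are dense -/

/-- Let `a`, `b`, `c` be the orders of `x`, `y`, `z`, so `a + b = (n + 1) c`. Keeping the powers
`t^i`, `t^(n+1-i)`, `t` and turning the remaining powers of `t` into powers of `t + s` preserves the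
equation; for `s ≠ 0` the result lies in the `i`-th explicit family. -/
lemma Arc.exists_mem_closure_of_ne_zero (φ : Arc k n) (hn : 1 ≤ n) (hz : φ.series 2 ≠ 0) :
    φ ∈ closure (explicitFamily k n (min (φ.series 0).order.toNat n)) := by
  have hxy : φ.series 0 * φ.series 1 ≠ 0 := by
    rw [φ.series_equation]
    exact pow_ne_zero _ hz
  have hx := left_ne_zero_of_mul hxy
  have hy := right_ne_zero_of_mul hxy
  have hpos : ∀ j, φ.series j ≠ 0 → 1 ≤ (φ.series j).order.toNat := by
    intro j hj
    have h : (φ.series j).order ≠ 0 :=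
      PowerSeries.order_ne_zero_iff_constCoeff_eq_zero.mpr (φ.centered j)
    rw [← PowerSeries.coe_toNat_order hj] at h
    have h' : (φ.series j).order.toNat ≠ 0 := by exact_mod_cast h
    omega
  have ha := hpos 0 hx
  have hb := hpos 1 hy
  have hc := hpos 2 hz
  obtain ⟨x, hx0, hx'⟩ := order_eq_iff_exists_unit.mp (PowerSeries.coe_toNat_order hx).symm
  obtain ⟨y, hy0, hy'⟩ := order_eq_iff_exists_unit.mp (PowerSeries.coe_toNat_order hy).symm
  obtain ⟨z, hz0, hz'⟩ := order_eq_iff_exists_unit.mp (PowerSeries.coe_toNat_order hz).symm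
  have habc : (φ.series 0).order.toNat + (φ.series 1).order.toNat =
      (n + 1) * (φ.series 2).order.toNat := by
    have h := congrArg PowerSeries.order φ.series_equation
    rw [PowerSeries.order_mul, PowerSeries.order_pow, ← PowerSeries.coe_toNat_order hx,
      ← PowerSeries.coe_toNat_order hy, ← PowerSeries.coe_toNat_order hz, nsmul_eq_mul] at h
    exact_mod_cast h
  generalize (φ.series 0).order.toNat = a at *
  generalize (φ.series 1).order.toNat = b at *
  generalize (φ.series 2).order.toNat = c at *
  have hxyz : x * y = z ^ (n + 1) := by
    have h := φ.series_equation
    rw [hx', hy', hz', mul_pow, ← pow_mul, mul_comm c, ← habc, pow_add] at h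
    have hX : (PowerSeries.X : PowerSeries k) ^ a * PowerSeries.X ^ b ≠ 0 :=
      mul_ne_zero (pow_ne_zero _ PowerSeries.X_ne_zero) (pow_ne_zero _ PowerSeries.X_ne_zero)
    exact mul_left_cancel₀ hX (by rw [← h]; ring)
  have hle : n + 1 ≤ a + b := by
    rw [habc]
    exact Nat.le_mul_of_pos_right _ hc
  -- Any `i` in `[1, n]` with `i ≤ a` and `n + 1 - i ≤ b` would do. This one works: if `i = a`,
  -- because `a + b ≥ n + 1`; if `i = n`, because `b ≥ 1`.
  set i := min a n with hi
  obtain ⟨a', ha'⟩ : ∃ a', a = i + a' := ⟨a - i, by omega⟩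
  obtain ⟨b', hb'⟩ : ∃ b', b = (n + 1 - i) + b' := ⟨b - (n + 1 - i), by omega⟩
  obtain ⟨c', hc'⟩ : ∃ c', c = 1 + c' := ⟨c - 1, by omega⟩
  have habc' : a' + b' = (n + 1) * c' := by
    have hin : i + (n + 1 - i) = n + 1 := by omega
    rw [hc', mul_add, mul_one] at habc
    omega
  let T : PowerSeries (Polynomial k) := PowerSeries.X + PowerSeries.C Polynomial.X
  let F : Fin 3 → PowerSeries (Polynomial k) :=
    ![PowerSeries.X ^ i * T ^ a' * PowerSeries.map Polynomial.C x,
      PowerSeries.X ^ (n + 1 - i) * T ^ b' * PowerSeries.map Polynomial.C y,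
      PowerSeries.X * T ^ c' * PowerSeries.map Polynomial.C z]
  have hF : F 0 * F 1 = F 2 ^ (n + 1) := by
    change (PowerSeries.X ^ i * T ^ a' * PowerSeries.map Polynomial.C x) *
      (PowerSeries.X ^ (n + 1 - i) * T ^ b' * PowerSeries.map Polynomial.C y) =
      (PowerSeries.X * T ^ c' * PowerSeries.map Polynomial.C z) ^ (n + 1)
    have hin : n + 1 = i + (n + 1 - i) := by omega
    have hX : (PowerSeries.X : PowerSeries (Polynomial k)) ^ (n + 1) =
        PowerSeries.X ^ i * PowerSeries.X ^ (n + 1 - i) := by rw [← pow_add, ← hin]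
    rw [mul_pow, mul_pow, ← map_pow (PowerSeries.map Polynomial.C), ← hxyz, map_mul, ← pow_mul,
      mul_comm c', ← habc', pow_add T, hX]
    ring
  have h0 : ∀ j, PowerSeries.constantCoeff (F j) = 0 := by
    have h1 : i ≠ 0 := by omega
    have h2 : n + 1 - i ≠ 0 := by omega
    intro j
    fin_cases j <;> simp [F, h1, h2]
  have hT : ∀ s : k, specialize s T = PowerSeries.X + PowerSeries.C s := by
    intro s
    simp [T]
  refine Arc.mem_closure_of_curve F hF h0 0 (fun j => ?_) Polynomial.X_ne_zero
    fun s hs => subset_closure ?_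
  · fin_cases j
    · change φ.series 0 = specialize 0 (_ * _ * _)
      rw [hx', map_mul, map_mul, map_pow, map_pow, hT, specialize_map_C, PowerSeries.map_X,
        map_zero, add_zero, ha', pow_add]
    · change φ.series 1 = specialize 0 (_ * _ * _)
      rw [hy', map_mul, map_mul, map_pow, map_pow, hT, specialize_map_C, PowerSeries.map_X,
        map_zero, add_zero, hb', pow_add]
    · change φ.series 2 = specialize 0 (_ * _ * _)
      rw [hz', map_mul, map_mul, map_pow, hT, specialize_map_C, PowerSeries.map_X,
        map_zero, add_zero, hc', pow_add, pow_one]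
  · rw [Polynomial.eval_X] at hs
    have hne : ∀ (m : ℕ) (f : PowerSeries k), PowerSeries.constantCoeff f ≠ 0 →
        PowerSeries.constantCoeff ((PowerSeries.X + PowerSeries.C s) ^ m * f) ≠ 0 := by
      intro m f hf
      simp [hf, hs]
    refine ⟨?_, ?_, ?_⟩ <;> rw [Arc.series_curve]
    · refine order_eq_iff_exists_unit.mpr ⟨_, hne a' x hx0, ?_⟩
      change specialize s (_ * _ * _) = _
      rw [map_mul, map_mul, map_pow, map_pow, hT, specialize_map_C, PowerSeries.map_X, mul_assoc]
    · refine order_eq_iff_exists_unit.mpr ⟨_, hne b' y hy0, ?_⟩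
      change specialize s (_ * _ * _) = _
      rw [map_mul, map_mul, map_pow, map_pow, hT, specialize_map_C, PowerSeries.map_X, mul_assoc]
    · rw [← Nat.cast_one (R := ℕ∞)]
      refine order_eq_iff_exists_unit.mpr ⟨_, hne c' z hz0, ?_⟩
      change specialize s (_ * _ * _) = _
      rw [map_mul, map_mul, map_pow, hT, specialize_map_C, PowerSeries.map_X, mul_assoc, pow_one]

/-- The order of `x` must be constant for `s ≠ 0`, so that all these arcs lie in the closure of one
and the same family. -/
lemma Arc.exists_mem_closure_of_curve {φ : Arc k n} (hn : 1 ≤ n)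
    (F : Fin 3 → PowerSeries (Polynomial k)) (hF : F 0 * F 1 = F 2 ^ (n + 1))
    (h0 : ∀ j, PowerSeries.constantCoeff (F j) = 0)
    (hφ : ∀ j, φ.series j = specialize 0 (F j))
    (hz : ∀ s : k, s ≠ 0 → specialize s (F 2) ≠ 0) {a : ℕ}
    (hx : ∀ s : k, s ≠ 0 → (specialize s (F 0)).order.toNat = a) :
    φ ∈ closure (explicitFamily k n (min a n)) := by
  refine Arc.mem_closure_of_curve F hF h0 0 hφ Polynomial.X_ne_zero fun s hs => ?_
  rw [Polynomial.eval_X] at hs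
  rw [← hx s hs, ← Arc.series_curve F hF h0]
  exact Arc.exists_mem_closure_of_ne_zero _ hn (by rw [Arc.series_curve]; exact hz s hs)

lemma Arc.exists_mem_closure_explicitFamily (hn : 1 ≤ n) (φ : Arc k n) :
    ∃ i, 1 ≤ i ∧ i ≤ n ∧ φ ∈ closure (explicitFamily k n i) := by
  suffices h : ∃ a, 1 ≤ a ∧ φ ∈ closure (explicitFamily k n (min a n)) by
    obtain ⟨a, ha, h⟩ := h
    exact ⟨min a n, by omega, by omega, h⟩
  have hpos : ∀ f : PowerSeries k, f ≠ 0 → PowerSeries.constantCoeff f = 0 →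
      1 ≤ f.order.toNat := by
    intro f hf hf0
    have h := PowerSeries.order_ne_zero_iff_constCoeff_eq_zero.mpr hf0
    rw [← PowerSeries.coe_toNat_order hf] at h
    have h' : f.order.toNat ≠ 0 := by exact_mod_cast h
    omega
  have hn0 : n ≠ 0 := by omega
  by_cases hz : φ.series 2 = 0
  swap
  · refine ⟨_, hpos _ (fun (hx : φ.series 0 = 0) => hz ?_) (φ.centered 0),
      φ.exists_mem_closure_of_ne_zero hn hz⟩
    have h := φ.series_equation
    rw [hx, zero_mul] at h
    exact pow_eq_zero_iff (by omega) |>.mp h.symm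
  have hxy : φ.series 0 = 0 ∨ φ.series 1 = 0 := by
    have h := φ.series_equation
    rw [hz, zero_pow (by omega)] at h
    exact mul_eq_zero.mp h
  by_cases hx : φ.series 0 = 0
  · by_cases hy : φ.series 1 = 0
    -- The constant arc is the limit of the arcs `(st, (st)^n, st)`.
    · refine ⟨1, le_rfl, Arc.exists_mem_closure_of_curve hn
        ![PowerSeries.C Polynomial.X * PowerSeries.X,
          (PowerSeries.C Polynomial.X * PowerSeries.X) ^ n,
          PowerSeries.C Polynomial.X * PowerSeries.X] ?_ ?_ ?_ ?_ ?_⟩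
      · simp only [Matrix.cons_val]
        ring
      · intro j
        fin_cases j <;> simp [hn0]
      · intro j
        fin_cases j <;> simp [hx, hy, hz, hn0]
      · intro s hs
        simp [hs]
      · intro s hs
        have hu : IsUnit (PowerSeries.C s) := (isUnit_iff_ne_zero.mpr hs).map _
        simp [PowerSeries.order_mul, PowerSeries.order_zero_of_unit hu]
    -- The arc `(0, y, 0)` is the limit of `(s^(n+1) y^n, y, s y)`; the remaining case exchanges `x`
    -- and `y`.
    · refine ⟨n * (φ.series 1).order.toNat, Nat.mul_pos hn (hpos _ hy (φ.centered 1)),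
        Arc.exists_mem_closure_of_curve hn
          ![PowerSeries.C (Polynomial.X ^ (n + 1)) * PowerSeries.map Polynomial.C (φ.series 1) ^ n,
            PowerSeries.map Polynomial.C (φ.series 1),
            PowerSeries.C Polynomial.X * PowerSeries.map Polynomial.C (φ.series 1)] ?_ ?_ ?_ ?_ ?_⟩
      · simp only [Matrix.cons_val, map_pow]
        ring
      · intro j
        have h := φ.centered 1
        change PowerSeries.constantCoeff (φ.series 1) = 0 at h
        fin_cases j <;> simp [constantCoeff_map_C, h, hn0]
      · intro j
        fin_cases j <;> simp [hx, hz, specialize_map_C]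
      · intro s hs
        simp [hs, specialize_map_C, hy]
      · intro s hs
        have hu : IsUnit (PowerSeries.C (s ^ (n + 1))) :=
          (isUnit_iff_ne_zero.mpr (pow_ne_zero _ hs)).map _
        simp only [Matrix.cons_val, map_mul, PowerSeries.map_C, map_pow (specialize s),
          specialize_map_C, Polynomial.coe_evalRingHom, Polynomial.eval_pow, Polynomial.eval_X]
        rw [PowerSeries.order_mul, PowerSeries.order_zero_of_unit hu, PowerSeries.order_pow]
        simp
  · have hy : φ.series 1 = 0 := hxy.resolve_left hx
    refine ⟨_, hpos _ hx (φ.centered 0), Arc.exists_mem_closure_of_curve hn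
      ![PowerSeries.map Polynomial.C (φ.series 0),
        PowerSeries.C (Polynomial.X ^ (n + 1)) * PowerSeries.map Polynomial.C (φ.series 0) ^ n,
        PowerSeries.C Polynomial.X * PowerSeries.map Polynomial.C (φ.series 0)] ?_ ?_ ?_ ?_ ?_⟩
    · simp only [Matrix.cons_val, map_pow]
      ring
    · intro j
      have h := φ.centered 0
      change PowerSeries.constantCoeff (φ.series 0) = 0 at h
      fin_cases j <;> simp [constantCoeff_map_C, h, hn0]
    · intro j
      fin_cases j <;> simp [hy, hz, specialize_map_C]
    · intro s hs
      simp [hs, specialize_map_C, hx]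
    · intro s hs
      simp only [Matrix.cons_val, specialize_map_C]

end Families

/-! ### Toric charts: the primes of the rays and the plane coordinates -/

section ChartRings

instance instIsDomainChartRing (k : Type u) [Field k] {n : ℕ} (τ : FanCone n) :
    IsDomain (ChartRing k τ) := by
  have : UniqueSums (dualMonoid τ) :=
    UniqueSums.of_injective_addHom (dualMonoid τ).subtype.toAddHom Subtype.val_injective
      inferInstance
  have : NoZeroDivisors (ChartRing k τ) := inferInstance
  exact NoZeroDivisors.to_isDomain _

/-- The value of a character on the ray through `(i, 1)`. -/
def rayValue (i : ℕ) (m : ℤ × ℤ) : ℤ :=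
  (i : ℤ) * m.1 + m.2

lemma rayValue_add (i : ℕ) (m m' : ℤ × ℤ) :
    rayValue i (m + m') = rayValue i m + rayValue i m' := by
  simp only [rayValue, Prod.fst_add, Prod.snd_add]
  ring

lemma rayValue_sub (i : ℕ) (m m' : ℤ × ℤ) :
    rayValue i (m - m') = rayValue i m - rayValue i m' := by
  simp only [rayValue, Prod.fst_sub, Prod.snd_sub]
  ring

lemma rayValue_nonneg {n : ℕ} {τ : FanCone n} {i : ℕ} (hi : i ∈ τ.1) (m : dualMonoid τ) :
    0 ≤ rayValue i m :=
  m.2 i hi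

variable (k : Type u) [Field k] {n : ℕ} (τ : FanCone n) {i : ℕ} (hi : i ∈ τ.1)

/-- The restriction of functions on a chart to the divisor of a ray of the cone. -/
noncomputable def rayHom : ChartRing k τ →ₐ[k] ChartRing k τ :=
  AddMonoidAlgebra.lift k _ _
    { toFun := fun m => if rayValue i m.toAdd = 0 then AddMonoidAlgebra.single m.toAdd 1 else 0
      map_one' := by
        simp [rayValue, AddMonoidAlgebra.one_def]
      -- The values on the ray are nonnegative, so a sum of two vanishes only if both do.
      map_mul' := fun m m' => by
        have h1 := rayValue_nonneg hi m.toAdd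
        have h2 := rayValue_nonneg hi m'.toAdd
        rw [toAdd_mul, AddSubmonoid.coe_add, rayValue_add]
        by_cases h : rayValue i m.toAdd = 0
        · by_cases h' : rayValue i m'.toAdd = 0
          · rw [if_pos h, if_pos h', if_pos (by omega), AddMonoidAlgebra.single_mul_single, mul_one]
          · rw [if_neg h', if_neg (by omega), mul_zero]
        · rw [if_neg h, if_neg (by omega), zero_mul] }

lemma rayHom_single (m : dualMonoid τ) (a : k) :
    rayHom k τ hi (AddMonoidAlgebra.single m a) =
      if rayValue i m = 0 then AddMonoidAlgebra.single m a else 0 := by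
  rw [rayHom, AddMonoidAlgebra.lift_single]
  simp

lemma rayHom_restrict {τ σ : FanCone n} (h : τ ≤ σ) (hi : i ∈ τ.1) (f : ChartRing k σ) :
    rayHom k τ hi (restrict k h f) = restrict k h (rayHom k σ (h hi) f) := by
  induction f using AddMonoidAlgebra.induction_linear with
  | zero => simp
  | add f g hf hg => simp only [map_add, hf, hg]
  | single m a =>
    rw [restrict_single, rayHom_single, rayHom_single, apply_ite (restrict k h), restrict_single,
      map_zero]
    rfl

/-- The prime ideal of the divisor of a ray of the cone. -/
noncomputable def rayPrime : Spec (CommRingCat.of (ChartRing k τ)) :=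
  PrimeSpectrum.mk (RingHom.ker (rayHom k τ hi)) (RingHom.ker_isPrime _)

lemma mem_rayPrime {f : ChartRing k τ} : f ∈ (rayPrime k τ hi).asIdeal ↔ rayHom k τ hi f = 0 :=
  Iff.rfl

lemma character_mem_rayPrime {m : ℤ × ℤ} (hm : m ∈ dualMonoid τ) :
    character k τ m hm ∈ (rayPrime k τ hi).asIdeal ↔ 0 < rayValue i m := by
  have h := rayValue_nonneg hi ⟨m, hm⟩
  rw [mem_rayPrime, character, rayHom_single]
  split_ifs with h0
  · simp only [AddMonoidAlgebra.single_eq_zero, one_ne_zero, false_iff]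
    exact h0.not_gt
  · simp only [true_iff]
    exact lt_of_le_of_ne h (Ne.symm h0)

lemma charts_map_rayPrime {τ σ : FanCone n} (f : τ ⟶ σ) (hi : i ∈ τ.1) :
    (charts k n).map f (rayPrime k τ hi) = rayPrime k σ (CategoryTheory.leOfHom f hi) := by
  refine PrimeSpectrum.ext (Ideal.ext fun a => ?_)
  change rayHom k τ hi (restrict k (CategoryTheory.leOfHom f) a) = 0 ↔ rayHom k σ _ a = 0
  rw [rayHom_restrict]
  exact map_eq_zero_iff _ (restrict_injective k _)

/-- `f - rayHom k τ hi f` collects the monomials of `f` with positive value on the ray. Subtracting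
`e` from such an exponent keeps it in the dual monoid, so each of them is divisible by the character
of `e`. -/
lemma rayPrime_eq_span {e : ℤ × ℤ} (he : e ∈ dualMonoid τ) (h1 : rayValue i e = 1)
    (h0 : ∀ j ∈ τ.1, j ≠ i → rayValue j e = 0) :
    (rayPrime k τ hi).asIdeal = Ideal.span {character k τ e he} := by
  apply le_antisymm
  · have key : ∀ f, f - rayHom k τ hi f ∈ Ideal.span {character k τ e he} := by
      intro f
      induction f using AddMonoidAlgebra.induction_linear with
      | zero => simp
      | add f g hf hg =>
        rw [map_add, add_sub_add_comm]
        exact add_mem hf hg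
      | single m a =>
        rw [rayHom_single]
        split_ifs with h
        · simp
        · have hm : (m : ℤ × ℤ) - e ∈ dualMonoid τ := by
            intro j hj
            change 0 ≤ rayValue j _
            rw [rayValue_sub]
            have hj' := rayValue_nonneg hj m
            by_cases hji : j = i
            · subst hji
              omega
            · rw [h0 j hj hji]
              omega
          rw [sub_zero, Ideal.mem_span_singleton]
          refine ⟨AddMonoidAlgebra.single ⟨_, hm⟩ a, ?_⟩
          rw [character, AddMonoidAlgebra.single_mul_single, one_mul]
          congr 1
          exact Subtype.ext (by simp)
    intro f hf
    have h := key f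
    rwa [(mem_rayPrime k τ hi).mp hf, sub_zero] at h
  · rw [Ideal.span_singleton_le_iff_mem, character_mem_rayPrime, h1]
    exact one_pos

/-- The two-dimensional cone spanned by `(l, 1)` and `(l + 1, 1)`. -/
def chamber {n l : ℕ} (hl : l ≤ n) : FanCone n :=
  ⟨{l, l + 1}, l, hl, subset_rfl⟩

/-- The cone spanned by `(i, 1)`. -/
def rayCone {n i : ℕ} (hi : i ≤ n) : FanCone n :=
  ⟨{i}, i, hi, by simp⟩

lemma mem_chamber {l : ℕ} {hl : l ≤ n} {j : ℕ} : j ∈ (chamber hl).1 ↔ j = l ∨ j = l + 1 := by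
  simp [chamber]

lemma mem_rayCone {l : ℕ} {hl : l ≤ n} {j : ℕ} : j ∈ (rayCone hl).1 ↔ j = l := by
  simp [rayCone]

variable {l : ℕ} (hl : l ≤ n)

lemma leftChar_mem : ((-1, (l : ℤ) + 1) : ℤ × ℤ) ∈ dualMonoid (chamber hl) := by
  intro j hj
  rcases mem_chamber.mp hj with rfl | rfl
  · simp
  · push_cast
    ring_nf
    rfl

lemma rightChar_mem : ((1, -(l : ℤ)) : ℤ × ℤ) ∈ dualMonoid (chamber hl) := by
  intro j hj
  rcases mem_chamber.mp hj with rfl | rfl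
  · simp
  · push_cast
    ring_nf
    exact zero_le_one

/-- The first coordinate of a chart; it vanishes on the divisor of `(l, 1)`. -/
noncomputable def leftCoord : ChartRing k (chamber hl) :=
  character k _ _ (leftChar_mem hl)

/-- The second coordinate of a chart; it vanishes on the divisor of `(l + 1, 1)`. -/
noncomputable def rightCoord : ChartRing k (chamber hl) :=
  character k _ _ (rightChar_mem hl)

lemma left_mem_chamber : l ∈ (chamber hl).1 := mem_chamber.mpr (.inl rfl)

lemma right_mem_chamber : l + 1 ∈ (chamber hl).1 := mem_chamber.mpr (.inr rfl)

lemma rayPrime_left :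
    (rayPrime k _ (left_mem_chamber hl)).asIdeal = Ideal.span {leftCoord k hl} := by
  refine rayPrime_eq_span k _ _ _ (by simp [rayValue]) fun j hj hjl => ?_
  obtain rfl := (mem_chamber.mp hj).resolve_left hjl
  simp [rayValue]

lemma rayPrime_right :
    (rayPrime k _ (right_mem_chamber hl)).asIdeal = Ideal.span {rightCoord k hl} := by
  refine rayPrime_eq_span k _ _ _ (by simp [rayValue]) fun j hj hjl => ?_
  obtain rfl := (mem_chamber.mp hj).resolve_right hjl
  simp [rayValue]

/-- The monomials `x`, `y`, `z` in the coordinates of a chart. -/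
lemma toChart_coord_chamber (j : Fin 3) : toChart k (chamber hl) (coord k n j) =
    toricMonomial n l (leftCoord k hl) (rightCoord k hl) j := by
  have hmn : (l : ℤ) + ((n - l : ℕ) : ℤ) = n := by omega
  have hmn' : (l : ℤ) + ((n + 1 - l : ℕ) : ℤ) = n + 1 := by omega
  rw [toChart_coord]
  fin_cases j <;>
    simp only [toricMonomial, Matrix.cons_val, leftCoord, rightCoord, character_pow,
      character_mul, Fin.zero_eta, Fin.mk_one, Fin.reduceFinMk] <;>
    congr 1 <;>
    simp only [coordChar, Matrix.cons_val, Prod.smul_mk, Prod.mk_add_mk, nsmul_eq_mul, mul_neg,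
      mul_one, Prod.mk.injEq, Nat.cast_add, Nat.cast_one] <;>
    constructor
  · ring
  · ring
  · linarith
  · have h3 : ((n + 1 - l : ℕ) : ℤ) = (n - l : ℕ) + 1 := by omega
    rw [h3, ← hmn]
    ring
  · ring
  · ring

/-- The point of a chart with given coordinates. -/
noncomputable def chartPoint {S : Type*} [CommRing S] [Algebra k S] (A B : S) :
    ChartRing k (chamber hl) →ₐ[k] S :=
  AddMonoidAlgebra.lift k _ _
    { toFun := fun m => A ^ (rayValue l m.toAdd).toNat * B ^ (rayValue (l + 1) m.toAdd).toNat
      map_one' := by simp [rayValue]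
      map_mul' := fun m m' => by
        have h1 := rayValue_nonneg (left_mem_chamber hl) m.toAdd
        have h2 := rayValue_nonneg (left_mem_chamber hl) m'.toAdd
        have h3 := rayValue_nonneg (right_mem_chamber hl) m.toAdd
        have h4 := rayValue_nonneg (right_mem_chamber hl) m'.toAdd
        rw [toAdd_mul, AddSubmonoid.coe_add, rayValue_add, rayValue_add, Int.toNat_add h1 h2,
          Int.toNat_add h3 h4, pow_add, pow_add]
        ring }

lemma chartPoint_character {S : Type*} [CommRing S] [Algebra k S] (A B : S) {m : ℤ × ℤ}
    (hm : m ∈ dualMonoid (chamber hl)) : chartPoint k hl A B (character k _ m hm) =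
      A ^ (rayValue l m).toNat * B ^ (rayValue (l + 1) m).toNat := by
  rw [chartPoint, character, AddMonoidAlgebra.lift_single, one_smul]
  rfl

lemma chartPoint_leftCoord {S : Type*} [CommRing S] [Algebra k S] (A B : S) :
    chartPoint k hl A B (leftCoord k hl) = A := by
  rw [leftCoord, chartPoint_character]
  simp [rayValue]

lemma chartPoint_rightCoord {S : Type*} [CommRing S] [Algebra k S] (A B : S) :
    chartPoint k hl A B (rightCoord k hl) = B := by
  rw [rightCoord, chartPoint_character]
  simp [rayValue]

end ChartRings

/-! ### Maximal irreducible subsets of a finite union -/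

section Topology

/-- An irreducible set inside a finite union of closed sets lies in one of them. This serves both
for the exceptional curves and, with `Z` the whole space, for the components of the arc space. -/
lemma maximal_isIrreducible_iff {X ι : Type*} [TopologicalSpace X] [Finite ι] {Z : Set X}
    {C : ι → Set X} (hirr : ∀ i, IsIrreducible (C i)) (hcl : ∀ i, IsClosed (C i))
    (hZ : Z = ⋃ i, C i) (hC : ∀ i j, C i ⊆ C j → i = j) (E : Set X) :
    Maximal (fun F : Set X => IsIrreducible F ∧ F ⊆ Z) E ↔ ∃ i, E = C i := by
  have hfin : (Set.range C).Finite := Set.finite_range C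
  have key : ∀ F : Set X, IsIrreducible F → F ⊆ Z → ∃ i, F ⊆ C i := by
    intro F hF hFZ
    obtain ⟨D, hD, hFD⟩ := isIrreducible_iff_sUnion_isClosed.mp hF hfin.toFinset
      (by simpa using hcl) (by simpa [hZ, Set.sUnion_range] using hFZ)
    obtain ⟨i, rfl⟩ := hfin.mem_toFinset.mp hD
    exact ⟨i, hFD⟩
  have hsub : ∀ i, C i ⊆ Z := fun i => hZ ▸ Set.subset_iUnion C i
  constructor
  · intro hE
    obtain ⟨i, hi⟩ := key E hE.prop.1 hE.prop.2
    exact ⟨i, hE.eq_of_subset ⟨hirr i, hsub i⟩ hi⟩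
  · rintro ⟨i, rfl⟩
    refine ⟨⟨hirr i, hsub i⟩, fun F hF hle => ?_⟩
    obtain ⟨j, hj⟩ := key F hF.1 hF.2
    obtain rfl := hC i j (hle.trans hj)
    exact hj

end Topology

/-! ### Transversality and orders of vanishing, computed in an affine chart -/

section Stalks

variable {R : Type u} [CommRing R]

/-- Functions on an affine scheme as germs. -/
noncomputable abbrev toGerm (x : Spec (CommRingCat.of R)) :
    R →+* (Spec (CommRingCat.of R)).presheaf.stalk x :=
  (StructureSheaf.toStalk R x).hom

instance isPrime_asIdeal (x : Spec (CommRingCat.of R)) : x.asIdeal.IsPrime :=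
  PrimeSpectrum.isPrime x

noncomputable instance stalkAlgebraSpec (x : Spec (CommRingCat.of R)) :
    Algebra R ((Spec (CommRingCat.of R)).presheaf.stalk x) :=
  (toGerm x).toAlgebra

instance isLocalization_stalkSpec (x : Spec (CommRingCat.of R)) :
    IsLocalization.AtPrime ((Spec (CommRingCat.of R)).presheaf.stalk x) x.asIdeal :=
  StructureSheaf.IsLocalization.to_stalk R x

/-- Every ideal of a localization is the extension of its contraction, and the contraction to `R` is
`Q`. -/
lemma idealAt_Spec {Q P : Spec (CommRingCat.of R)} (h : Q ⤳ P) :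
    idealAt h = Q.asIdeal.map (toGerm P) := by
  rw [← IsLocalization.map_under P.asIdeal.primeCompl
    ((Spec (CommRingCat.of R)).presheaf.stalk P) (idealAt h)]
  change Ideal.map (toGerm P) (Ideal.comap (toGerm P) (idealAt h)) = _
  congr 1
  rw [idealAt, Ideal.comap_comap]
  have h1 : ((Spec (CommRingCat.of R)).presheaf.stalkSpecializes h).hom.comp (toGerm P) =
      toGerm Q :=
    congrArg CommRingCat.Hom.hom (StructureSheaf.toStalk_stalkSpecializes (R := R) h)
  rw [h1]
  exact IsLocalization.AtPrime.under_maximalIdeal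
    ((Spec (CommRingCat.of R)).presheaf.stalk Q) Q.asIdeal

lemma map_idealAt_of_isOpenImmersion {X Y : Scheme.{u}} (f : Y ⟶ X) [IsOpenImmersion f] {y x : Y}
    (h : f y ⤳ f x) (h' : y ⤳ x) : (idealAt h).map (f.stalkMap x).hom = idealAt h' := by
  have h1 : idealAt h = (idealAt h').comap (f.stalkMap x).hom := by
    rw [idealAt, idealAt, ← IsLocalRing.maximalIdeal_comap (f.stalkMap y).hom, Ideal.comap_comap,
      Ideal.comap_comap]
    congr 1
    exact congrArg CommRingCat.Hom.hom (Scheme.Hom.stalkSpecializes_stalkMap f y x h')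
  rw [h1]
  exact Ideal.map_comap_of_surjective _
    (ConcreteCategory.bijective_of_isIso (C := CommRingCat) (f.stalkMap x)).2 _

variable {S : Type u} [CommRing S]

lemma stalkMap_toGerm (g : R →+* S) (x : Spec (CommRingCat.of S)) :
    ((Spec.map (CommRingCat.ofHom g)).stalkMap x).hom.comp
      (toGerm (Spec.map (CommRingCat.ofHom g) x)) = (toGerm x).comp g :=
  congrArg CommRingCat.Hom.hom (stalkMap_toStalk (CommRingCat.ofHom g) x)

lemma toGerm_bijective [IsLocalRing S] {o : Spec (CommRingCat.of S)}
    (ho : o.asIdeal = IsLocalRing.maximalIdeal S) : Function.Bijective (toGerm o) := by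
  have hu : ∀ x ∈ o.asIdeal.primeCompl, IsUnit x := by
    intro x (hx : x ∉ o.asIdeal)
    rw [ho] at hx
    exact IsLocalRing.notMem_maximalIdeal.mp hx
  exact (IsLocalization.atUnits S o.asIdeal.primeCompl
    (S := (Spec (CommRingCat.of S)).presheaf.stalk o) hu).bijective

/-- Stalk maps of open immersions are isomorphisms and a local ring equals its stalk at the closed
point, so transversality can be read off from the image of a local equation `e` of the divisor. -/
lemma map_idealAt_eq_maximalIdeal_iff [IsLocalRing S] {X : Scheme.{u}}
    (f : Spec (CommRingCat.of R) ⟶ X) [IsOpenImmersion f] {Q : Spec (CommRingCat.of R)} {e : R}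
    (hQ : Q.asIdeal = Ideal.span {e}) (g : R →+* S) {o : Spec (CommRingCat.of S)}
    (ho : o.asIdeal = IsLocalRing.maximalIdeal S)
    (h : f Q ⤳ (Spec.map (CommRingCat.ofHom g) ≫ f) o) :
    (idealAt h).map ((Spec.map (CommRingCat.ofHom g) ≫ f).stalkMap o).hom =
      IsLocalRing.maximalIdeal ((Spec (CommRingCat.of S)).presheaf.stalk o) ↔
    Ideal.span {g e} = IsLocalRing.maximalIdeal S := by
  have h' : Q ⤳ Spec.map (CommRingCat.ofHom g) o :=
    f.isOpenEmbedding.isInducing.specializes_iff.mp h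
  have h1 : (idealAt h).map ((Spec.map (CommRingCat.ofHom g) ≫ f).stalkMap o).hom =
      (Ideal.span {g e}).map (toGerm o) := by
    have h2 := map_idealAt_of_isOpenImmersion f h h'
    have h5 := congrArg CommRingCat.Hom.hom
      (Scheme.Hom.stalkMap_comp (Spec.map (CommRingCat.ofHom g)) f o)
    refine (congrArg (fun φ => (idealAt h).map φ) h5).trans ?_
    refine (Ideal.map_map _ _).symm.trans ((congrArg (Ideal.map _) h2).trans ?_)
    rw [idealAt_Spec h', Ideal.map_map]
    refine (congrArg (fun φ : R →+* _ => Q.asIdeal.map φ) (stalkMap_toGerm g o)).trans ?_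
    rw [hQ, ← Ideal.map_map, Ideal.map_span, Set.image_singleton]
  have h3 : (IsLocalRing.maximalIdeal S).map (toGerm o) =
      IsLocalRing.maximalIdeal ((Spec (CommRingCat.of S)).presheaf.stalk o) := by
    rw [← ho]
    exact IsLocalization.AtPrime.map_eq_maximalIdeal o.asIdeal _
  rw [h1, ← h3]
  refine ⟨fun h4 => ?_, fun h4 => by rw [h4]⟩
  have h5 := congrArg (Ideal.comap (toGerm o)) h4
  rwa [Ideal.comap_map_of_bijective _ (toGerm_bijective ho),
    Ideal.comap_map_of_bijective _ (toGerm_bijective ho)] at h5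

lemma ord_eq_one_of_span_eq_maximalIdeal {L : Type*} [CommRing L] [IsLocalRing L] {a : L}
    (h : Ideal.span {a} = IsLocalRing.maximalIdeal L) : Ring.ord L a = 1 := by
  rw [Ring.ord, Module.length_eq_one_iff, isSimpleModule_iff_isCoatom, ← Ideal.isMaximal_def, h]
  infer_instance

/-- The stalk is the localization of `R` at `Q`, whose maximal ideal is generated by `e`; there `v`
is a unit, so the order of `e ^ m * v` is `m`. -/
lemma ord_germ_eq [IsDomain R] {T : Type u} [CommRing T] {X : Scheme.{u}}
    (f : Spec (CommRingCat.of R) ⟶ X) [IsOpenImmersion f] (p : X ⟶ Spec (CommRingCat.of T))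
    (g : T →+* R) (hp : f ≫ p = Spec.map (CommRingCat.ofHom g))
    {Q : Spec (CommRingCat.of R)} {e : R}
    (hQ : Q.asIdeal = Ideal.span {e}) (he : e ≠ 0) {t : T} {m : ℕ} {v : R}
    (ht : g t = e ^ m * v) (hv : v ∉ Q.asIdeal) :
    Ring.ord (X.presheaf.stalk (f Q)) ((X.presheaf.germ ⊤ (f Q) trivial).hom
      (p.appTop.hom ((Scheme.ΓSpecIso (CommRingCat.of T)).inv.hom t))) = m := by
  let j : X.presheaf.stalk (f Q) ≃+* (Spec (CommRingCat.of R)).presheaf.stalk Q :=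
    RingEquiv.ofBijective (f.stalkMap Q).hom
      (ConcreteCategory.bijective_of_isIso (C := CommRingCat) (f.stalkMap Q))
  have : IsDomain ((Spec (CommRingCat.of R)).presheaf.stalk Q) :=
    IsLocalization.isDomain_of_le_nonZeroDivisors (M := Q.asIdeal.primeCompl) _
      (Ideal.primeCompl_le_nonZeroDivisors _)
  have : IsDomain (X.presheaf.stalk (f Q)) := j.toMulEquiv.isDomain _
  have hgerm : j ((X.presheaf.germ ⊤ (f Q) trivial).hom
      (p.appTop.hom ((Scheme.ΓSpecIso (CommRingCat.of T)).inv.hom t))) = toGerm Q (g t) := by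
    change (f.stalkMap Q).hom _ = _
    have h2 : p.appTop ≫ f.appTop = (Spec.map (CommRingCat.ofHom g)).appTop := by
      rw [← Scheme.Hom.comp_appTop, hp]
    have h3 : X.presheaf.germ ⊤ (f Q) trivial ≫ f.stalkMap Q =
        f.appTop ≫ (Spec (CommRingCat.of R)).presheaf.germ ⊤ Q trivial :=
      Scheme.Hom.germ_stalkMap f ⊤ Q trivial
    have h4 : (Scheme.ΓSpecIso (CommRingCat.of T)).inv ≫ p.appTop ≫
        X.presheaf.germ ⊤ (f Q) trivial ≫ f.stalkMap Q =
        CommRingCat.ofHom g ≫ StructureSheaf.toStalk R Q := by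
      rw [h3, reassoc_of% h2, ← Scheme.ΓSpecIso_inv_naturality_assoc]
      rfl
    exact congrArg (fun φ : CommRingCat.of T ⟶ _ => φ.hom t) h4
  have hu : IsUnit (toGerm Q v) :=
    IsLocalization.map_units (M := Q.asIdeal.primeCompl)
      ((Spec (CommRingCat.of R)).presheaf.stalk Q) ⟨v, hv⟩
  have hmax : Ideal.span {toGerm Q e} =
      IsLocalRing.maximalIdeal ((Spec (CommRingCat.of R)).presheaf.stalk Q) := by
    rw [← IsLocalization.AtPrime.map_eq_maximalIdeal Q.asIdeal, hQ, Ideal.map_span,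
      Set.image_singleton]
    rfl
  have hinj : Function.Injective (toGerm Q) :=
    IsLocalization.injective (M := Q.asIdeal.primeCompl)
      ((Spec (CommRingCat.of R)).presheaf.stalk Q) (Ideal.primeCompl_le_nonZeroDivisors _)
  have he' : j.symm (toGerm Q e) ≠ 0 := by
    rw [ne_eq, EmbeddingLike.map_eq_zero_iff, map_eq_zero_iff _ hinj]
    exact he
  have hmax' : Ideal.span {j.symm (toGerm Q e)} =
      IsLocalRing.maximalIdeal (X.presheaf.stalk (f Q)) := by
    rw [← IsLocalRing.maximalIdeal_comap (f.stalkMap Q).hom, ← hmax]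
    change _ = Ideal.comap j _
    rw [← Ideal.map_symm, Ideal.map_span, Set.image_singleton]
  have h1 : (X.presheaf.germ ⊤ (f Q) trivial).hom
      (p.appTop.hom ((Scheme.ΓSpecIso (CommRingCat.of T)).inv.hom t)) =
      j.symm (toGerm Q e) ^ m * j.symm (toGerm Q v) := by
    apply j.injective
    rw [hgerm, ht, map_mul, map_pow, map_mul, map_pow, j.apply_symm_apply, j.apply_symm_apply]
  rw [h1, Ring.ord_mul_of_isUnit_right (hu.map j.symm),
    Ring.ord_pow (mem_nonZeroDivisors_of_ne_zero he'), ord_eq_one_of_span_eq_maximalIdeal hmax',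
    nsmul_eq_mul, mul_one]

end Stalks

/-! ### Points of the resolution and its fibre over the singular point -/

section Resolution

variable (k : Type u) [Field k] {n : ℕ}

/-- The inclusion of a chart in the resolution. -/
noncomputable def chartι (τ : FanCone n) :
    Spec (CommRingCat.of (ChartRing k τ)) ⟶ resolution k n :=
  colimit.ι (charts k n) τ

instance isOpenImmersion_chartι (τ : FanCone n) : IsOpenImmersion (chartι k τ) :=
  inferInstanceAs (IsOpenImmersion (colimit.ι (charts k n) τ))

lemma chartι_map {τ σ : FanCone n} (f : τ ⟶ σ) (P : Spec (CommRingCat.of (ChartRing k τ))) :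
    chartι k σ ((charts k n).map f P) = chartι k τ P := by
  have h : (charts k n).map f ≫ chartι k σ = chartι k τ := colimit.w (charts k n) f
  rw [← h]
  rfl

lemma chartι_resolutionMap (τ : FanCone n) : chartι k τ ≫ resolutionMap k n =
    Spec.map (CommRingCat.ofHom (toChart k τ).toRingHom) :=
  colimit.ι_desc _ τ

lemma exists_chamber_point (x : resolution k n) :
    ∃ (l : ℕ) (hl : l ≤ n) (P : Spec (CommRingCat.of (ChartRing k (chamber hl)))),
      chartι k (chamber hl) P = x := by
  obtain ⟨τ, P, hP⟩ := Scheme.IsLocallyDirected.ι_jointly_surjective (charts k n) x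
  obtain ⟨l, hl, hτ⟩ := τ.2
  let f : τ ⟶ chamber hl := homOfLE hτ
  exact ⟨l, hl, (charts k n).map f P, (chartι_map k f P).trans hP⟩

/-- The generic point of the divisor of the ray through `(i, 1)`. -/
noncomputable def rayPoint {i : ℕ} (hi : i ≤ n) : resolution k n :=
  chartι k (rayCone hi) (rayPrime k (rayCone hi) (mem_rayCone.mpr rfl))

lemma chartι_rayPrime (τ : FanCone n) {i : ℕ} (hin : i ≤ n) (hi : i ∈ τ.1) :
    chartι k τ (rayPrime k τ hi) = rayPoint k hin := by
  let f : rayCone hin ⟶ τ := homOfLE (Finset.singleton_subset_iff.mpr hi)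
  rw [rayPoint, ← charts_map_rayPrime k f (mem_rayCone.mpr rfl)]
  exact chartι_map k f _

/-- A point lying in two charts comes from the chart of a common face. If `τ` lacks the ray, the
common face with the cone of the ray is the zero cone, where `z` is a unit; but `z` vanishes at the
generic point of the divisor. -/
lemma mem_of_chartι_eq_rayPoint {τ : FanCone n} {i : ℕ} {hin : i ≤ n}
    {P : Spec (CommRingCat.of (ChartRing k τ))} (h : chartι k τ P = rayPoint k hin) : i ∈ τ.1 := by
  obtain ⟨κ, f, g, x, -, hx⟩ :=
    (Scheme.IsLocallyDirected.ι_eq_ι_iff (charts k n)).mp h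
  by_contra hi
  have hempty : ∀ j, j ∉ κ.1 := by
    intro j hj
    have h1 : j ∈ τ.1 := leOfHom f hj
    have h2 := mem_rayCone.mp (leOfHom g hj)
    exact hi (h2 ▸ h1)
  have h1 := (character_mem_rayPrime k (rayCone hin) (mem_rayCone.mpr rfl)
    (coordChar_mem (rayCone hin) 2)).mpr (by simp [rayValue, coordChar])
  rw [← hx] at h1
  have h2 : restrict k (leOfHom g) (character k (rayCone hin) (coordChar n 2)
    (coordChar_mem (rayCone hin) 2)) ∈ PrimeSpectrum.asIdeal x := h1
  have h3 : IsUnit (restrict k (leOfHom g) (character k (rayCone hin) (coordChar n 2)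
      (coordChar_mem (rayCone hin) 2))) := by
    have hm : -coordChar n 2 ∈ dualMonoid κ := fun j hj => (hempty j hj).elim
    refine .of_mul_eq_one (character k κ _ hm) ?_
    rw [restrict_character, character_mul, ← character_zero]
    congr 1
  exact (PrimeSpectrum.isPrime x).ne_top (Ideal.eq_top_of_isUnit_mem _ h2 h3)

/-- A generization of a point of an open chart lies in that chart, so the specialization is visible
on prime ideals there. -/
lemma rayPoint_specializes_iff {τ : FanCone n} {i : ℕ} {hin : i ≤ n}
    {P : Spec (CommRingCat.of (ChartRing k τ))} :
    rayPoint k hin ⤳ chartι k τ P ↔ ∃ hi : i ∈ τ.1, (rayPrime k τ hi).asIdeal ≤ P.asIdeal := by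
  have key : ∀ hi : i ∈ τ.1, rayPoint k hin ⤳ chartι k τ P ↔
      (rayPrime k τ hi).asIdeal ≤ P.asIdeal := by
    intro hi
    rw [← chartι_rayPrime k τ hin hi, (chartι k τ).isOpenEmbedding.isInducing.specializes_iff]
    exact (PrimeSpectrum.le_iff_specializes _ _).symm
  constructor
  · intro h
    obtain ⟨Q, hQ⟩ := h.mem_open (chartι k τ).isOpenEmbedding.isOpen_range ⟨P, rfl⟩
    have hi := mem_of_chartι_eq_rayPoint k hQ
    exact ⟨hi, (key hi).mp h⟩
  · rintro ⟨hi, h⟩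
    exact (key hi).mpr h

lemma eq_of_rayPoint_specializes {i j : ℕ} {hi : i ≤ n} {hj : j ≤ n}
    (h : rayPoint k hi ⤳ rayPoint k hj) : i = j :=
  mem_rayCone.mp ((rayPoint_specializes_iff k).mp h).1

lemma chartι_mem_fibre_iff {τ : FanCone n} {P : Spec (CommRingCat.of (ChartRing k τ))} :
    chartι k τ P ∈ resolutionMap k n ⁻¹' origin k n ↔
      ∀ j, character k τ (coordChar n j) (coordChar_mem τ j) ∈ P.asIdeal := by
  have h : resolutionMap k n (chartι k τ P) =
      Spec.map (CommRingCat.ofHom (toChart k τ).toRingHom) P := by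
    rw [← chartι_resolutionMap]
    rfl
  rw [Set.mem_preimage, h, origin]
  change Set.range (coord k n) ⊆ _ ↔ _
  rw [Set.range_subset_iff]
  refine forall_congr' fun j => ?_
  rw [← toChart_coord]
  rfl

/-- The exceptional curves, as subsets of the resolution. -/
noncomputable def excCurve (i : Fin n) : Set (resolution k n) :=
  closure {rayPoint k (show (i : ℕ) + 1 ≤ n by omega)}

lemma mem_excCurve_iff {i : Fin n} {m : ℕ} (hm : m ≤ n) (hi : m = i + 1)
    {x : resolution k n} : x ∈ excCurve k i ↔ rayPoint k hm ⤳ x := by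
  subst hi
  exact specializes_iff_mem_closure.symm

lemma rayPoint_mem_fibre {i : ℕ} (hi : 1 ≤ i) (hin : i ≤ n) :
    rayPoint k hin ∈ resolutionMap k n ⁻¹' origin k n := by
  rw [rayPoint, chartι_mem_fibre_iff]
  intro j
  have h := character_mem_rayPrime k (rayCone hin) (mem_rayCone.mpr rfl)
    (coordChar_mem (rayCone hin) j)
  refine h.mpr ?_
  fin_cases j <;> simp [rayValue, coordChar] <;> omega

/-- In a chart with two exceptional axes, `z = A B = 0` puts the point on one of them. In the first
and last charts one axis is not exceptional; there `x = B` for `l = 0` and `y = A` for `l = n` pick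
out the exceptional one. -/
lemma fibre_eq_iUnion (hn : 1 ≤ n) :
    resolutionMap k n ⁻¹' origin k n = ⋃ i : Fin n, excCurve k i := by
  apply subset_antisymm
  · intro x hx
    obtain ⟨l, hl, P, rfl⟩ := exists_chamber_point k x
    rw [chartι_mem_fibre_iff] at hx
    have hP : P.asIdeal.IsPrime := inferInstance
    simp only [← toChart_coord, toChart_coord_chamber] at hx
    have hleft : leftCoord k hl ∈ P.asIdeal → 1 ≤ l →
        chartι k (chamber hl) P ∈ ⋃ i : Fin n, excCurve k i := by
      intro h hl1
      refine Set.mem_iUnion.mpr ⟨⟨l - 1, by omega⟩, ?_⟩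
      rw [mem_excCurve_iff k hl (by simp; omega), rayPoint_specializes_iff]
      refine ⟨left_mem_chamber hl, ?_⟩
      rwa [rayPrime_left, Ideal.span_singleton_le_iff_mem]
    have hright : rightCoord k hl ∈ P.asIdeal → l + 1 ≤ n →
        chartι k (chamber hl) P ∈ ⋃ i : Fin n, excCurve k i := by
      intro h hl1
      refine Set.mem_iUnion.mpr ⟨⟨l, by omega⟩, ?_⟩
      rw [mem_excCurve_iff k hl1 rfl, rayPoint_specializes_iff]
      refine ⟨right_mem_chamber hl, ?_⟩
      rwa [rayPrime_right, Ideal.span_singleton_le_iff_mem]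
    rcases Nat.eq_zero_or_pos l with rfl | hl1
    · refine hright ?_ hn
      have h := hx 0
      simpa [toricMonomial] using h
    rcases hl.eq_or_lt with rfl | hl2
    · refine hleft ?_ hl1
      have h := hx 1
      simpa [toricMonomial] using h
    · have h : leftCoord k hl * rightCoord k hl ∈ P.asIdeal := hx 2
      rcases hP.mem_or_mem h with h | h
      · exact hleft h hl1
      · exact hright h hl2
  · refine Set.iUnion_subset fun i => closure_minimal ?_ ?_
    · exact Set.singleton_subset_iff.mpr (rayPoint_mem_fibre k (by omega) _)
    · exact (PrimeSpectrum.isClosed_zeroLocus _).preimage (resolutionMap k n).continuous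

end Resolution

/-! ### The exceptional curves, their intersections and orders -/

section ExceptionalCurves

variable (k : Type u) [Field k] {n : ℕ}

lemma eq_of_excCurve_subset {i j : Fin n} (h : excCurve k i ⊆ excCurve k j) : i = j := by
  have h1 : rayPoint k (show (j : ℕ) + 1 ≤ n by omega) ⤳
      rayPoint k (show (i : ℕ) + 1 ≤ n by omega) :=
    (mem_excCurve_iff k _ rfl).mp (h (subset_closure rfl))
  have h2 := eq_of_rayPoint_specializes k h1
  omega

lemma mem_exceptionalCurves_iff (hn : 1 ≤ n) {E : Set (resolution k n)} :
    E ∈ exceptionalCurves (resolutionMap k n) ↔ ∃ i, E = excCurve k i :=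
  mem_exceptionalCurves.trans (maximal_isIrreducible_iff
    (fun _ => isIrreducible_singleton.closure) (fun _ => isClosed_closure)
    (fibre_eq_iUnion k hn) (fun _ _ => eq_of_excCurve_subset k) E)

/-- The numbering of the exceptional curves. -/
noncomputable def excEquiv (hn : 1 ≤ n) : Fin n ≃ exceptionalCurves (resolutionMap k n) :=
  Equiv.ofBijective (fun i => ⟨excCurve k i, (mem_exceptionalCurves_iff k hn).mpr ⟨i, rfl⟩⟩)
    ⟨fun _ _ h => eq_of_excCurve_subset k (congrArg Subtype.val h).subset, fun E => by
      obtain ⟨i, hi⟩ := (mem_exceptionalCurves_iff k hn).mp E.2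
      exact ⟨i, Subtype.ext hi.symm⟩⟩

lemma genericPt_excEquiv (hn : 1 ≤ n) (i : Fin n) {m : ℕ} (hm : m ≤ n) (hi : m = i + 1) :
    genericPt (resolutionMap k n) (excEquiv k hn i) = rayPoint k hm := by
  subst hi
  have h : IsGenericPoint (genericPt (resolutionMap k n) (excEquiv k hn i))
      (closure (excCurve k i)) :=
    (Maximal.prop (mem_exceptionalCurves.mp
      (excEquiv k hn i).2)).1.isGenericPoint_genericPoint_closure
  rw [excCurve, closure_closure] at h
  exact h.eq isGenericPoint_closure

/-- A common point lies in a chart whose cone has both rays, so their indices differ by at most one.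
Conversely, the origin of the chart between two neighbouring rays lies on both curves. -/
lemma excCurve_inter_nonempty_iff (i j : Fin n) :
    (excCurve k i ∩ excCurve k j).Nonempty ↔ (i : ℕ) ≤ j + 1 ∧ (j : ℕ) ≤ i + 1 := by
  have hi : (i : ℕ) + 1 ≤ n := by omega
  have hj : (j : ℕ) + 1 ≤ n := by omega
  constructor
  · rintro ⟨x, hxi, hxj⟩
    obtain ⟨l, hl, P, rfl⟩ := exists_chamber_point k x
    rw [mem_excCurve_iff k hi rfl, rayPoint_specializes_iff] at hxi
    rw [mem_excCurve_iff k hj rfl, rayPoint_specializes_iff] at hxj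
    have h1 := mem_chamber.mp hxi.1
    have h2 := mem_chamber.mp hxj.1
    omega
  · have key : ∀ i j : Fin n, (j : ℕ) = i + 1 → (excCurve k i ∩ excCurve k j).Nonempty := by
      intro i j hij
      have hi : (i : ℕ) + 1 ≤ n := by omega
      have hj : (i : ℕ) + 1 + 1 ≤ n := by omega
      let g : ChartRing k (chamber hi) →+* k := (chartPoint k hi (0 : k) 0).toRingHom
      let P : Spec (CommRingCat.of (ChartRing k (chamber hi))) :=
        PrimeSpectrum.mk (RingHom.ker g) (RingHom.ker_isPrime g)
      refine ⟨chartι k _ P, ?_, ?_⟩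
      · rw [mem_excCurve_iff k hi rfl, rayPoint_specializes_iff]
        refine ⟨left_mem_chamber hi, ?_⟩
        rw [rayPrime_left, Ideal.span_singleton_le_iff_mem]
        exact chartPoint_leftCoord k hi (0 : k) 0
      · rw [mem_excCurve_iff k hj (by omega), rayPoint_specializes_iff]
        refine ⟨right_mem_chamber hi, ?_⟩
        rw [rayPrime_right, Ideal.span_singleton_le_iff_mem]
        exact chartPoint_rightCoord k hi (0 : k) 0
    rintro ⟨h1, h2⟩
    rcases lt_trichotomy (i : ℕ) j with h | h | h
    · exact key i j (by omega)
    · obtain rfl := Fin.ext h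
      exact ⟨_, subset_closure rfl, subset_closure rfl⟩
    · rw [Set.inter_comm]
      exact key j i (by omega)

/-- The character `z` has value `1` on every ray, so it is a uniformizer along each curve. Dividing
a coordinate by `z ^ m` leaves a character of value `0` on the ray, which does not vanish at the
generic point. -/
lemma ordAlong_excEquiv (hn : 1 ≤ n) (i : Fin n) (j : Fin 3) (m : ℕ)
    (hm : rayValue (i + 1) (coordChar n j) = m) :
    ordAlong (resolutionMap k n) (excEquiv k hn i) (coord k n j) = m := by
  have hin : (i : ℕ) + 1 ≤ n := by omega
  have hmem : (i : ℕ) + 1 ∈ (rayCone hin).1 := mem_rayCone.mpr rfl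
  have hv0 : rayValue (i + 1) (coordChar n j - (m : ℤ) • (0, 1)) = 0 := by
    rw [rayValue_sub, hm]
    simp [rayValue]
  have hv : coordChar n j - (m : ℤ) • (0, 1) ∈ dualMonoid (rayCone hin) := by
    intro l hl
    rw [mem_rayCone.mp hl]
    exact hv0.ge
  have hQ := rayPrime_eq_span k (rayCone hin) hmem (coordChar_mem (rayCone hin) 2)
    (by simp [rayValue, coordChar]) (fun l hl hne => (hne (mem_rayCone.mp hl)).elim)
  -- The stalk depends on the point, so the equality of generic points is substituted for a variable
  -- `x` rather than rewritten.
  have key : ∀ x : resolution k n, x = rayPoint k hin →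
      Ring.ord ((resolution k n).presheaf.stalk x)
        (((resolution k n).presheaf.germ ⊤ x trivial).hom
        ((resolutionMap k n).appTop.hom
          ((Scheme.ΓSpecIso (CommRingCat.of (CoordRing k n))).inv.hom (coord k n j)))) = m := by
    rintro _ rfl
    refine ord_germ_eq (chartι k (rayCone hin)) (resolutionMap k n) _
      (chartι_resolutionMap k (rayCone hin)) hQ ?_ (v := character k _ _ hv) ?_ ?_
    · exact AddMonoidAlgebra.single_ne_zero.mpr one_ne_zero
    · refine (toChart_coord k _ j).trans ?_
      rw [character_pow, character_mul]
      congr 1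
      simp [coordChar]
    · intro h
      exact ((character_mem_rayPrime k (rayCone hin) hmem hv).mp h).ne' hv0
  exact key _ (genericPt_excEquiv k hn i hin rfl)

end ExceptionalCurves

/-! ### Lifts of arcs as pairs of power series -/

section ArcFamilies

variable (k : Type u) [Field k] {n : ℕ}

lemma span_eq_maximalIdeal_iff {f : PowerSeries k} :
    Ideal.span {f} = IsLocalRing.maximalIdeal (PowerSeries k) ↔ f.order = 1 := by
  rw [PowerSeries.maximalIdeal_eq_span_X, Ideal.span_singleton_eq_span_singleton,
    ← Nat.cast_one (R := ℕ∞), order_eq_iff_exists_unit]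
  constructor
  · intro h
    obtain ⟨u, hu⟩ := h.symm
    exact ⟨u, isUnit_iff_constantCoeff_ne_zero.mp u.isUnit, by rw [pow_one, hu]⟩
  · rintro ⟨g, hg, rfl⟩
    obtain ⟨u, rfl⟩ := isUnit_iff_constantCoeff_ne_zero.mpr hg
    rw [pow_one]
    exact (Associated.symm ⟨u, rfl⟩)

lemma map_arcOrigin_mem_excCurve_iff {τ : FanCone n} (g : ChartRing k τ →+* PowerSeries k)
    (i : Fin n) (hi : (i : ℕ) + 1 ∈ τ.1) {e : ChartRing k τ}
    (he : (rayPrime k τ hi).asIdeal = Ideal.span {e}) :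
    (Spec.map (CommRingCat.ofHom g) ≫ chartι k τ) (arcOrigin k) ∈ excCurve k i ↔
      ¬ IsUnit (g e) := by
  have hin : (i : ℕ) + 1 ≤ n := by omega
  rw [mem_excCurve_iff k hin rfl]
  refine (rayPoint_specializes_iff k
    (P := Spec.map (CommRingCat.ofHom g) (arcOrigin k))).trans ?_
  rw [exists_prop_of_true hi, he, Ideal.span_singleton_le_iff_mem]
  exact IsLocalRing.mem_maximalIdeal _

lemma mem_cone_of_map_arcOrigin_mem_excCurve {τ : FanCone n}
    (g : ChartRing k τ →+* PowerSeries k) (i : Fin n)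
    (h : (Spec.map (CommRingCat.ofHom g) ≫ chartι k τ) (arcOrigin k) ∈ excCurve k i) :
    (i : ℕ) + 1 ∈ τ.1 := by
  rw [mem_excCurve_iff k (show (i : ℕ) + 1 ≤ n by omega) rfl] at h
  exact ((rayPoint_specializes_iff k
    (P := Spec.map (CommRingCat.ofHom g) (arcOrigin k))).mp h).1

lemma meetsTransversally_iff (hn : 1 ≤ n) {τ : FanCone n} (g : ChartRing k τ →+* PowerSeries k)
    (i : Fin n) (hi : (i : ℕ) + 1 ∈ τ.1) {e : ChartRing k τ}
    (he : (rayPrime k τ hi).asIdeal = Ideal.span {e}) :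
    MeetsTransversally (resolutionMap k n) (Spec.map (CommRingCat.ofHom g) ≫ chartι k τ)
      (excEquiv k hn i) ↔ (g e).order = 1 := by
  have hin : (i : ℕ) + 1 ≤ n := by omega
  have hgen : genericPt (resolutionMap k n) (excEquiv k hn i) = chartι k τ (rayPrime k τ hi) :=
    (genericPt_excEquiv k hn i hin rfl).trans (chartι_rayPrime k τ hin hi).symm
  rw [MeetsTransversally, hgen, ← span_eq_maximalIdeal_iff]
  have key := map_idealAt_eq_maximalIdeal_iff (chartι k τ) he g (o := arcOrigin k) rfl
  refine ⟨fun ⟨h, h'⟩ => (key h).mp h', fun h => ?_⟩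
  have hs : chartι k τ (rayPrime k τ hi) ⤳
      (Spec.map (CommRingCat.ofHom g) ≫ chartι k τ) (arcOrigin k) := by
    rw [chartι_rayPrime k τ hin hi]
    refine (mem_excCurve_iff k hin rfl).mp ((map_arcOrigin_mem_excCurve_iff k g i hi he).mpr ?_)
    rw [← mem_nonunits_iff, ← IsLocalRing.mem_maximalIdeal, ← h]
    exact Ideal.mem_span_singleton_self _
  exact ⟨hs, (key hs).mpr h⟩

/-- Every point of `Spec k⟦t⟧` specializes to the closed point, so the whole arc stays in any open
chart containing the image of the closed point. -/
lemma exists_lift_chart (ψ : Spec (CommRingCat.of (PowerSeries k)) ⟶ resolution k n) :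
    ∃ (l : ℕ) (hl : l ≤ n) (g : ChartRing k (chamber hl) →+* PowerSeries k),
      ψ = Spec.map (CommRingCat.ofHom g) ≫ chartι k (chamber hl) := by
  obtain ⟨l, hl, P, hP⟩ := exists_chamber_point k (ψ (arcOrigin k))
  have hr : Set.range ψ ⊆ Set.range (chartι k (chamber hl)) := by
    rintro _ ⟨y, rfl⟩
    have hy : y ⤳ arcOrigin k := IsLocalRing.specializes_closedPoint y
    exact (hy.map ψ.continuous).mem_open (chartι k (chamber hl)).isOpenEmbedding.isOpen_range
      ⟨P, hP⟩
  refine ⟨l, hl, (Spec.preimage (IsOpenImmersion.lift (chartι k (chamber hl)) ψ hr)).hom, ?_⟩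
  rw [CommRingCat.ofHom_hom, Spec.map_preimage, IsOpenImmersion.lift_fac]

lemma lift_comp_resolutionMap_eq_iff {l : ℕ} (hl : l ≤ n)
    (g : ChartRing k (chamber hl) →+* PowerSeries k) (φ : Arc k n) :
    (Spec.map (CommRingCat.ofHom g) ≫ chartι k (chamber hl)) ≫ resolutionMap k n = φ.toHom ↔
      g.comp (toChart k (chamber hl)).toRingHom = φ.hom.toRingHom := by
  rw [Category.assoc, chartι_resolutionMap, ← Spec.map_comp, ← CommRingCat.ofHom_comp, Arc.toHom,
    Spec.map_injective.eq_iff]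
  exact ⟨fun h => congrArg CommRingCat.Hom.hom h, fun h => by rw [h]⟩

lemma forall_notMem_iff (hn : 1 ≤ n) (i : Fin n) (x : resolution k n) :
    (∀ E' : exceptionalCurves (resolutionMap k n), E' ≠ excEquiv k hn i →
      x ∉ (E' : Set (resolution k n))) ↔ ∀ j : Fin n, j ≠ i → x ∉ excCurve k j := by
  constructor
  · exact fun h j hj => h (excEquiv k hn j) fun e => hj ((excEquiv k hn).injective e)
  · intro h E' hE'
    obtain ⟨j, rfl⟩ := (excEquiv k hn).surjective E'
    exact h j fun e => hE' (congrArg _ e)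

/-- The only other curve that reaches this chart is that of the ray `l + 1`, which is exceptional
only if `l < n`; hence the guard. -/
lemma forall_notMem_excCurve_iff_left {l : ℕ} (hl : l ≤ n)
    (g : ChartRing k (chamber hl) →+* PowerSeries k) (i : Fin n) (hi : (i : ℕ) + 1 = l) :
    (∀ j : Fin n, j ≠ i → (Spec.map (CommRingCat.ofHom g) ≫ chartι k _) (arcOrigin k) ∉
      excCurve k j) ↔ (l < n → PowerSeries.constantCoeff (g (rightCoord k hl)) ≠ 0) := by
  have key : ∀ hln : l < n, (Spec.map (CommRingCat.ofHom g) ≫ chartι k _) (arcOrigin k) ∉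
      excCurve k ⟨l, hln⟩ ↔ PowerSeries.constantCoeff (g (rightCoord k hl)) ≠ 0 := by
    intro hln
    rw [map_arcOrigin_mem_excCurve_iff k g ⟨l, hln⟩ (right_mem_chamber hl)
      (rayPrime_right k hl), not_not, isUnit_iff_constantCoeff_ne_zero]
  constructor
  · intro h hln
    exact (key hln).mp (h _ (by rw [ne_eq, Fin.ext_iff]; simp only; omega))
  · intro h j hji hj
    have hjm := mem_chamber.mp (mem_cone_of_map_arcOrigin_mem_excCurve k _ j hj)
    rw [ne_eq, Fin.ext_iff] at hji
    have hln : l < n := by omega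
    obtain rfl : j = ⟨l, hln⟩ := Fin.ext (by simp only; omega)
    exact (key hln).mpr (h hln) hj

lemma forall_notMem_excCurve_iff_right {l : ℕ} (hl : l ≤ n)
    (g : ChartRing k (chamber hl) →+* PowerSeries k) (i : Fin n) (hi : (i : ℕ) = l) :
    (∀ j : Fin n, j ≠ i → (Spec.map (CommRingCat.ofHom g) ≫ chartι k _) (arcOrigin k) ∉
      excCurve k j) ↔ (0 < l → PowerSeries.constantCoeff (g (leftCoord k hl)) ≠ 0) := by
  have key : ∀ j : Fin n, (j : ℕ) + 1 = l →
      ((Spec.map (CommRingCat.ofHom g) ≫ chartι k _) (arcOrigin k) ∉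
        excCurve k j ↔ PowerSeries.constantCoeff (g (leftCoord k hl)) ≠ 0) := by
    rintro j rfl
    rw [map_arcOrigin_mem_excCurve_iff k g j (left_mem_chamber hl)
      (rayPrime_left k hl), not_not, isUnit_iff_constantCoeff_ne_zero]
  constructor
  · intro h hl0
    have hj : l - 1 + 1 = l := by omega
    exact (key ⟨l - 1, by omega⟩ hj).mp (h _ (by rw [ne_eq, Fin.ext_iff]; simp only; omega))
  · intro h j hji hj
    have hjm := mem_chamber.mp (mem_cone_of_map_arcOrigin_mem_excCurve k _ j hj)
    rw [ne_eq, Fin.ext_iff] at hji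
    exact (key j (by omega)).mpr (h (by omega)) hj

lemma arcFamily_subset_transversalFamily (hn : 1 ≤ n) (i : Fin n) :
    arcFamily (resolutionMap k n) (excEquiv k hn i) ⊆ transversalFamily k n (i + 1) := by
  rintro φ ⟨ψ, hψ, htr, hother⟩
  rw [forall_notMem_iff] at hother
  obtain ⟨l, hl, g, rfl⟩ := exists_lift_chart k ψ
  rw [lift_comp_resolutionMap_eq_iff] at hψ
  have hser : ∀ j, φ.series j =
      toricMonomial n l (g (leftCoord k hl)) (g (rightCoord k hl)) j := by
    intro j
    rw [← map_toricMonomial g, ← toChart_coord_chamber]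
    exact (RingHom.congr_fun hψ (coord k n j)).symm
  have hmem : (i : ℕ) + 1 ∈ (chamber hl).1 := by
    obtain ⟨hs, -⟩ := htr
    rw [genericPt_excEquiv k hn i (by omega) rfl] at hs
    exact mem_cone_of_map_arcOrigin_mem_excCurve k g i ((mem_excCurve_iff k _ rfl).mpr hs)
  refine ⟨g (leftCoord k hl), g (rightCoord k hl), ?_⟩
  -- The curve of the ray `i + 1` is either the left axis of the chart `l = i + 1` or the right axis
  -- of the chart `l = i`: the two alternatives in `transversalFamily`.
  rcases mem_chamber.mp hmem with h | h
  · subst h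
    exact .inl ⟨hser, (meetsTransversally_iff k hn g i _ (rayPrime_left k hl)).mp htr,
      (forall_notMem_excCurve_iff_left k hl g i rfl).mp hother⟩
  · obtain rfl : (i : ℕ) = l := by omega
    refine .inr ⟨hser, (meetsTransversally_iff k hn g i _ (rayPrime_right k hl)).mp htr,
      fun hi => (forall_notMem_excCurve_iff_right k hl g i rfl).mp hother (by omega)⟩

/-- The chart is an affine plane, so any pair `(A, B)` defines a morphism to it; it lifts `φ`
because homomorphisms from the coordinate ring are determined on `x`, `y`, `z`. -/
lemma exists_chart_hom {φ : Arc k n} {l : ℕ} (hl : l ≤ n) {A B : PowerSeries k}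
    (h : ∀ j, φ.series j = toricMonomial n l A B j) :
    ∃ g : ChartRing k (chamber hl) →+* PowerSeries k, g (leftCoord k hl) = A ∧
      g (rightCoord k hl) = B ∧
      (Spec.map (CommRingCat.ofHom g) ≫ chartι k (chamber hl)) ≫ resolutionMap k n = φ.toHom := by
  have hA := chartPoint_leftCoord k hl A B
  have hB := chartPoint_rightCoord k hl A B
  refine ⟨(chartPoint k hl A B).toRingHom, hA, hB, ?_⟩
  rw [lift_comp_resolutionMap_eq_iff]
  have h1 : (chartPoint k hl A B).comp (toChart k (chamber hl)) = φ.hom := by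
    refine Ideal.Quotient.algHom_ext _ (MvPolynomial.algHom_ext fun j => ?_)
    refine Eq.trans ?_ (h j).symm
    change chartPoint k hl A B (toChart k (chamber hl) (coord k n j)) = _
    rw [toChart_coord_chamber]
    refine (map_toricMonomial (chartPoint k hl A B).toRingHom n l _ _ j).trans ?_
    exact congrArg₂ (toricMonomial n l · · j) hA hB
  rw [← h1]
  rfl

lemma transversalFamily_subset_arcFamily (hn : 1 ≤ n) (i : Fin n) :
    transversalFamily k n (i + 1) ⊆ arcFamily (resolutionMap k n) (excEquiv k hn i) := by
  rintro φ ⟨A, B, ⟨h, hA, hB⟩ | ⟨h, hB, hA⟩⟩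
  · have hl : (i : ℕ) + 1 ≤ n := by omega
    obtain ⟨g, rfl, rfl, hg⟩ := exists_chart_hom k hl h
    refine ⟨_, hg, ?_, ?_⟩
    · exact (meetsTransversally_iff k hn g i (left_mem_chamber hl) (rayPrime_left k hl)).mpr hA
    · rw [forall_notMem_iff]
      exact (forall_notMem_excCurve_iff_left k hl g i rfl).mpr hB
  · have hl : (i : ℕ) ≤ n := by omega
    rw [Nat.add_sub_cancel] at h
    obtain ⟨g, rfl, rfl, hg⟩ := exists_chart_hom k hl h
    refine ⟨_, hg, ?_, ?_⟩
    · exact (meetsTransversally_iff k hn g i (right_mem_chamber hl) (rayPrime_right k hl)).mpr hB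
    · rw [forall_notMem_iff]
      exact (forall_notMem_excCurve_iff_right k hl g i rfl).mpr fun hi => hA (by omega)

lemma arcFamily_excEquiv (hn : 1 ≤ n) (i : Fin n) :
    arcFamily (resolutionMap k n) (excEquiv k hn i) = transversalFamily k n (i + 1) :=
  subset_antisymm (arcFamily_subset_transversalFamily k hn i)
    (transversalFamily_subset_arcFamily k hn i)

end ArcFamilies

end AnNash

theorem mainTheorem4 {k : Type u} [Field k] [Infinite k] {n : ℕ} (hn : 1 ≤ n) :
    ∃ E : Fin n ≃ AnNash.exceptionalCurves (AnNash.resolutionMap k n),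
      -- the dual graph is a chain, numbered in order (`E i` is the curve with number `i + 1`)
      (∀ i j : Fin n, ((E i : Set (AnNash.resolution k n)) ∩ (E j : Set _)).Nonempty ↔
        (i : ℕ) ≤ j + 1 ∧ (j : ℕ) ≤ i + 1) ∧
      -- the orders of `x` and of `y` along the exceptional curves
      (∀ i : Fin n,
        AnNash.ordAlong (AnNash.resolutionMap k n) (E i) (AnNash.coord k n 0) =
          (((i : ℕ) + 1 : ℕ) : ℕ∞) ∧
        AnNash.ordAlong (AnNash.resolutionMap k n) (E i) (AnNash.coord k n 1) =
          ((n + 1 - ((i : ℕ) + 1) : ℕ) : ℕ∞)) ∧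
      -- the closures of the families are pairwise not included in one another
      (∀ i j : Fin n, i ≠ j →
        ¬ closure (AnNash.arcFamily (AnNash.resolutionMap k n) (E i)) ⊆
          closure (AnNash.arcFamily (AnNash.resolutionMap k n) (E j))) ∧
      -- the explicit parametrized families
      (∀ i : Fin n,
        AnNash.arcFamily (AnNash.resolutionMap k n) (E i) ∩
            {φ | PowerSeries.coeff 1 (φ.series 2) ≠ 0} =
          AnNash.explicitFamily k n (i + 1)) ∧
      (∀ i : Fin n, 0 < (i : ℕ) → (i : ℕ) + 1 < n →
        AnNash.arcFamily (AnNash.resolutionMap k n) (E i) =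
          AnNash.explicitFamily k n (i + 1)) ∧
      (∀ i : Fin n,
        closure (AnNash.arcFamily (AnNash.resolutionMap k n) (E i)) =
          closure (AnNash.explicitFamily k n (i + 1))) ∧
      (∀ i j : Fin n, i ≠ j →
        ¬ closure (AnNash.explicitFamily k n (i + 1)) ⊆
          closure (AnNash.explicitFamily k n (j + 1))) ∧
      -- the Nash conjecture
      (∀ i : Fin n, IsIrreducible (AnNash.arcFamily (AnNash.resolutionMap k n) (E i))) ∧
      (⋃ i : Fin n, closure (AnNash.arcFamily (AnNash.resolutionMap k n) (E i))) = Set.univ ∧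
      irreducibleComponents (AnNash.Arc k n) =
        Set.range
          (fun i : Fin n => closure (AnNash.arcFamily (AnNash.resolutionMap k n) (E i))) ∧
      (irreducibleComponents (AnNash.Arc k n)).ncard =
        (AnNash.exceptionalCurves (AnNash.resolutionMap k n)).ncard ∧
      (irreducibleComponents (AnNash.Arc k n)).ncard = n := by
  have hi : ∀ i : Fin n, 1 ≤ (i : ℕ) + 1 ∧ (i : ℕ) + 1 ≤ n := fun i => by omega
  have hcl : ∀ i : Fin n, closure (AnNash.transversalFamily k n (i + 1)) =
      closure (AnNash.explicitFamily k n (i + 1)) :=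
    fun i => AnNash.closure_transversalFamily (hi i).1 (hi i).2
  have hsub : ∀ i j : Fin n, closure (AnNash.explicitFamily k n (i + 1)) ⊆
      closure (AnNash.explicitFamily k n (j + 1)) → i = j := by
    intro i j h
    by_contra hij
    refine AnNash.not_explicitFamily_subset_closure (hi i).1 (hi i).2 (hi j).2 (fun h' => hij ?_)
      (subset_closure.trans h)
    exact Fin.ext (by omega)
  have hunion : (⋃ i : Fin n, closure (AnNash.explicitFamily k n (i + 1))) = Set.univ := by
    refine Set.eq_univ_of_forall fun φ => ?_
    obtain ⟨m, hm, hmn, h⟩ := AnNash.Arc.exists_mem_closure_explicitFamily hn φ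
    refine Set.mem_iUnion.mpr ⟨⟨m - 1, by omega⟩, ?_⟩
    have hm' : m - 1 + 1 = m := by omega
    simpa only [hm'] using h
  have hcomp : irreducibleComponents (AnNash.Arc k n) =
      Set.range (fun i : Fin n => closure (AnNash.explicitFamily k n (i + 1))) := by
    ext E
    have h := AnNash.maximal_isIrreducible_iff
      (fun i : Fin n => (AnNash.isIrreducible_explicitFamily (k := k) (hi i).1 (hi i).2).closure)
      (fun _ => isClosed_closure) hunion.symm hsub E
    simp only [Set.subset_univ, and_true] at h
    refine h.trans ?_
    simp only [Set.mem_range, eq_comm]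
  have hcard : (irreducibleComponents (AnNash.Arc k n)).ncard = n := by
    rw [hcomp, ← Set.image_univ, Set.ncard_image_of_injective _ fun i j h => hsub i j h.subset,
      Set.ncard_univ, Nat.card_fin]
  refine ⟨AnNash.excEquiv k hn, ?_⟩
  -- From here every closure is that of an explicit family, to which the facts above apply.
  simp only [AnNash.arcFamily_excEquiv, hcl]
  refine ⟨fun i j => AnNash.excCurve_inter_nonempty_iff k i j, fun i => ⟨?_, ?_⟩,
    fun i j hij h => hij (hsub i j h), fun i => AnNash.transversalFamily_inter (hi i).1 (hi i).2,
    fun i h1 h2 => AnNash.transversalFamily_eq_explicitFamily (by omega) h2, fun _ => trivial,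
    fun i j hij h => hij (hsub i j h),
    fun i => AnNash.isIrreducible_transversalFamily (hi i).1 (hi i).2, hunion, hcomp, ?_, hcard⟩
  · refine AnNash.ordAlong_excEquiv k hn i 0 _ ?_
    simp [AnNash.rayValue, AnNash.coordChar]
  · refine AnNash.ordAlong_excEquiv k hn i 1 _ ?_
    have h := (hi i).2
    simp only [AnNash.rayValue, AnNash.coordChar, Matrix.cons_val]
    omega
  · rw [hcard, ← Nat.card_coe_set_eq, ← Nat.card_congr (AnNash.excEquiv k hn), Nat.card_fin]
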